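/- **Theorem 1.** Let $\mathcal X,\mathcal Y$ be measurable spaces, and let $\mathcal H_X$, $\mathcal H_Y$ be finite-dimensional real reproducing kernel Hilbert spaces of functions on $\mathcal X$, $\mathcal Y$ with measurable kernels $k_X,k_Y$. Let $(X,Y)$ have distribution $F=F_{XY}$ on $\mathcal X\times\mathcal Y$ with $E[k_X(X,X)]<\infty$ and $E[k_Y(Y,Y)]<\infty$. Write $\tilde k_X(\cdot,x)=k_X(\cdot,x)-E[k_X(\cdot,X)]$, and similarly $\tilde k_Y$. With $(a\otimes b)v=\langle v,b\rangle a$, put $\Sigma_{XY}=E[\tilde k_X(\cdot,X)\otimes\tilde k_Y(\cdot,Y)]:\mathcal H_Y\to\mathcal H_X$, and define $\Sigma_{YX},\Sigma_{XX},\Sigma_{YY}$ likewise. Assume that $\Sigma_{XX}$ and $\Sigma_{YY}$ are invertible. For any distribution with these invertibility properties, let $\rho_1\ge\rho_2\ge\cdots\ge 0$ be the kernel canonical correlations, that is, the singular values, with multiplicity, of $\Sigma_{YY}^{-1/2}\Sigma_{YX}\Sigma_{XX}^{-1/2}$. The $j$-th kernel canonical variates are solutions of $$(\Sigma_{XY}\Sigma_{YY}^{-1}\Sigma_{YX}-\rho_j^2\Sigma_{XX})f_{jX}=0,\quad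 \langle f_{jX},\Sigma_{XX}f_{jX}\rangle=1,$$ $$(\Sigma_{YX}\Sigma_{XX}^{-1}\Sigma_{XY}-\rho_j^2\Sigma_{YY})f_{jY}=0,\quad \langle f_{jY},\Sigma_{YY}f_{jY}\rangle=1.$$ Fix $j$ with $1\le j\le\min(\dim\mathcal H_X,\dim\mathcal H_Y)$. Assume that, at $F$, $\rho_j^2$ is a simple eigenvalue of both $S_X=\Sigma_{XX}^{-1/2}\Sigma_{XY}\Sigma_{YY}^{-1}\Sigma_{YX}\Sigma_{XX}^{-1/2}$ and $S_Y=\Sigma_{YY}^{-1/2}\Sigma_{YX}\Sigma_{XX}^{-1}\Sigma_{XY}\Sigma_{YY}^{-1/2}$. Let $(f_{jX},f_{jY})$ be a pair with $\Sigma_{XY}f_{jY}=\rho_j\Sigma_{XX}f_{jX}$, $\Sigma_{YX}f_{jX}=\rho_j\Sigma_{YY}f_{jY}$ and $\langle f_{jX},\Sigma_{XX}f_{jX}\rangle=\langle f_{jY},\Sigma_{YY}f_{jY}\rangle=1$. Put $\tilde f_{jX}(x)=\langle f_{jX},\tilde k_X(\cdot,x)\rangle$, $\tilde f_{jY}(y)=\langle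 f_{jY},\tilde k_Y(\cdot,y)\rangle$, $$\mathbb L_{jX}=\Sigma_{XX}^{-1/2}(S_X-\rho_j^2I)^{+}\Sigma_{XX}^{-1/2},\qquad \mathbb L_{jY}=\Sigma_{YY}^{-1/2}(S_Y-\rho_j^2I)^{+}\Sigma_{YY}^{-1/2},$$ where $^+$ is the Moore–Penrose inverse. For a point $Z'=(X',Y')\in\mathcal X\times\mathcal Y$ let $F_\varepsilon=(1-\varepsilon)F+\varepsilon\delta_{Z'}$. The influence function of a functional $T$ at $Z'$ is $\mathrm{IF}(Z',T)=\lim_{\varepsilon\downarrow0}(T(F_\varepsilon)-T(F))/\varepsilon$, the limit being taken in norm when $T$ takes values in an RKHS. Then for all sufficiently small $\varepsilon>0$ there is exactly one $j$-th kernel canonical variate of $F_\varepsilon$ on the side of $X$ that has positive covariance under $F$ with $f_{jX}$, and exactly one on the side of $Y$ that has positive covariance under $F$ with $f_{jY}$. For $\rho_j^2$ and for the variates so chosen at $F_\varepsilon$ (equal to $f_{jX}$, $f_{jY}$ at $F$), the influence functions exist and are $$\mathrm{IF}(Z',\rho_j^2)=-\rho_j^2\tilde f_{jX}(X')^2+2\rho_j\tilde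 f_{jX}(X')\tilde f_{jY}(Y')-\rho_j^2\tilde f_{jY}(Y')^2,$$ $$\begin{aligned}\mathrm{IF}(\cdot,Z',f_{jX})={}&-\rho_j[\tilde f_{jY}(Y')-\rho_j\tilde f_{jX}(X')]\,\mathbb L_{jX}\tilde k_X(\cdot,X')\\&-[\tilde f_{jX}(X')-\rho_j\tilde f_{jY}(Y')]\,\mathbb L_{jX}\Sigma_{XY}\Sigma_{YY}^{-1}\tilde k_Y(\cdot,Y')+\tfrac12[1-\tilde f_{jX}(X')^2]f_{jX},\end{aligned}$$ $$\begin{aligned}\mathrm{IF}(\cdot,Z',f_{jY})={}&-\rho_j[\tilde f_{jX}(X')-\rho_j\tilde f_{jY}(Y')]\,\mathbb L_{jY}\tilde k_Y(\cdot,Y')\\&-[\tilde f_{jY}(Y')-\rho_j\tilde f_{jX}(X')]\,\mathbb L_{jY}\Sigma_{YX}\Sigma_{XX}^{-1}\tilde k_X(\cdot,X')+\tfrac12[1-\tilde f_{jY}(Y')^2]f_{jY}.\end{aligned}$$ Here all operators, $\rho_j$, $\tilde f_{jX}$ and $\tilde f_{jY}$ on the right are taken at $F$. -/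

import Mathlib

open MeasureTheory Filter Topology
open scoped InnerProductSpace

noncomputable section

namespace KCCA

/-- The feature vector `k(·, x)` of a real reproducing kernel Hilbert space of functions on `𝒳`. -/
def feature {𝒳 : Type*} (H : Type*) [NormedAddCommGroup H] [InnerProductSpace ℝ H]
    [CompleteSpace H] [RKHS ℝ H 𝒳 ℝ] (x : 𝒳) : H :=
  RKHS.kerFun H x (1 : ℝ)

/-- The scalar reproducing kernel `k(x, x')`. -/
def scalarKernel {𝒳 : Type*} (H : Type*) [NormedAddCommGroup H] [InnerProductSpace ℝ H]
    [CompleteSpace H] [RKHS ℝ H 𝒳 ℝ] (x x' : 𝒳) : ℝ :=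
  RKHS.kernel H x x' (1 : ℝ)

/-- `k_X(·, X)` as a random element on `𝒳 × 𝒴`. -/
def featX {𝒳 : Type*} (𝒴 : Type*) (H : Type*) [NormedAddCommGroup H] [InnerProductSpace ℝ H]
    [CompleteSpace H] [RKHS ℝ H 𝒳 ℝ] (z : 𝒳 × 𝒴) : H :=
  feature H z.1

/-- `k_Y(·, Y)` as a random element on `𝒳 × 𝒴`. -/
def featY (𝒳 : Type*) {𝒴 : Type*} (H : Type*) [NormedAddCommGroup H] [InnerProductSpace ℝ H]
    [CompleteSpace H] [RKHS ℝ H 𝒴 ℝ] (z : 𝒳 × 𝒴) : H :=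
  feature H z.2

section Operators

variable {Ω : Type*} [MeasurableSpace Ω]
  {H₁ : Type*} [NormedAddCommGroup H₁] [InnerProductSpace ℝ H₁]
  {H₂ : Type*} [NormedAddCommGroup H₂] [InnerProductSpace ℝ H₂]

/-- The centered feature `U(ω) - E_P[U]`. -/
def centered (P : Measure Ω) (U : Ω → H₁) (ω : Ω) : H₁ :=
  U ω - ∫ ω', U ω' ∂P

/-- The centered cross-covariance operator `Σ_UV = E_P[Ũ ⊗ Ṽ] : H₂ → H₁`, where
`(a ⊗ b) v = ⟪v, b⟫ a`. The covariance operator of `U` is `Σ_UU = crossCov P U U`. -/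
def crossCov (P : Measure Ω) (U : Ω → H₁) (V : Ω → H₂) : H₂ →L[ℝ] H₁ :=
  ∫ ω, InnerProductSpace.rankOne ℝ (centered P U ω) (centered P V ω) ∂P

/-- The spectral functional calculus `φ(T) = ∑_μ φ(μ) P_μ` of a self-adjoint operator `T` on a
finite-dimensional space; `P_μ` is the orthogonal projection onto the eigenspace of `μ`. -/
def symFun [FiniteDimensional ℝ H₁] (T : H₁ →L[ℝ] H₁) (φ : ℝ → ℝ) : H₁ →L[ℝ] H₁ :=
  ∑ᶠ μ : ℝ, φ μ • (Module.End.eigenspace (T : H₁ →ₗ[ℝ] H₁) μ).starProjection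

/-- `T^{-1/2}` for a positive definite `T`. -/
def invSqrt [FiniteDimensional ℝ H₁] (T : H₁ →L[ℝ] H₁) : H₁ →L[ℝ] H₁ :=
  symFun T fun t => (√t)⁻¹

/-- The Moore-Penrose inverse of a self-adjoint `T`: the convention `0⁻¹ = 0` makes it vanish on the
kernel of `T`, and it inverts `T` on the orthogonal complement of the kernel. -/
def pinv [FiniteDimensional ℝ H₁] (T : H₁ →L[ℝ] H₁) : H₁ →L[ℝ] H₁ :=
  symFun T fun t => t⁻¹

variable [FiniteDimensional ℝ H₁] [FiniteDimensional ℝ H₂]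

/-- The correlation operator `Σ_VV^{-1/2} Σ_VU Σ_UU^{-1/2} : H₁ → H₂`. -/
def corrOp (P : Measure Ω) (U : Ω → H₁) (V : Ω → H₂) : H₁ →L[ℝ] H₂ :=
  invSqrt (crossCov P V V) ∘L crossCov P V U ∘L invSqrt (crossCov P U U)

/-- The kernel canonical correlations: the singular values of the correlation operator, in
decreasing order and with multiplicity, numbered from `0`. -/
def kernelCC (P : Measure Ω) (U : Ω → H₁) (V : Ω → H₂) (j : ℕ) : ℝ :=
  LinearMap.singularValues (corrOp P U V : H₁ →ₗ[ℝ] H₂) j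

/-- `Σ_UU^{-1/2} Σ_UV Σ_VV^{-1} Σ_VU Σ_UU^{-1/2}`. -/
def ccaOp (P : Measure Ω) (U : Ω → H₁) (V : Ω → H₂) : H₁ →L[ℝ] H₁ :=
  invSqrt (crossCov P U U) ∘L crossCov P U V ∘L Ring.inverse (crossCov P V V) ∘L
    crossCov P V U ∘L invSqrt (crossCov P U U)

/-- `L = Σ_UU^{-1/2} (Σ_UU^{-1/2} Σ_UV Σ_VV^{-1} Σ_VU Σ_UU^{-1/2} - ρ² I)⁺ Σ_UU^{-1/2}`. -/
def resolventOp (P : Measure Ω) (U : Ω → H₁) (V : Ω → H₂) (ρ : ℝ) : H₁ →L[ℝ] H₁ :=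
  invSqrt (crossCov P U U) ∘L
    pinv (ccaOp P U V - ρ ^ 2 • ContinuousLinearMap.id ℝ H₁) ∘L invSqrt (crossCov P U U)

end Operators

section Variates

variable {Ω : Type*} [MeasurableSpace Ω]
  {H₁ : Type*} [NormedAddCommGroup H₁] [InnerProductSpace ℝ H₁]
  {H₂ : Type*} [NormedAddCommGroup H₂] [InnerProductSpace ℝ H₂]

/-- `ρ²` is a simple eigenvalue of `Σ_UU^{-1/2} Σ_UV Σ_VV^{-1} Σ_VU Σ_UU^{-1/2}`. -/
def IsSimpleCC [FiniteDimensional ℝ H₁] [FiniteDimensional ℝ H₂]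
    (P : Measure Ω) (U : Ω → H₁) (V : Ω → H₂) (ρ : ℝ) : Prop :=
  Module.finrank ℝ (Module.End.eigenspace (ccaOp P U V : H₁ →ₗ[ℝ] H₁) (ρ ^ 2)) = 1

/-- `f` is a canonical variate, on the side of `U`, for the canonical correlation `ρ`: it solves
`(Σ_UV Σ_VV^{-1} Σ_VU - ρ² Σ_UU) f = 0` and has unit variance. -/
structure IsVariate (P : Measure Ω) (U : Ω → H₁) (V : Ω → H₂) (ρ : ℝ) (f : H₁) : Prop where
  eigen : crossCov P U V (Ring.inverse (crossCov P V V) (crossCov P V U f)) =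
    ρ ^ 2 • crossCov P U U f
  unit_variance : ⟪f, crossCov P U U f⟫_ℝ = 1

/-- `(f, g)` is a pair of canonical variates for the canonical correlation `ρ`. -/
structure IsCanonicalPair (P : Measure Ω) (U : Ω → H₁) (V : Ω → H₂) (ρ : ℝ) (f : H₁) (g : H₂) :
    Prop where
  left : crossCov P U V g = ρ • crossCov P U U f
  right : crossCov P V U f = ρ • crossCov P V V g
  unit_variance_left : ⟪f, crossCov P U U f⟫_ℝ = 1
  unit_variance_right : ⟪g, crossCov P V V g⟫_ℝ = 1

/-- The contaminated distribution `(1 - ε) F + ε δ_z`. -/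
def contaminate (F : Measure Ω) (z : Ω) (ε : ℝ) : Measure Ω :=
  ENNReal.ofReal (1 - ε) • F + ENNReal.ofReal ε • Measure.dirac z

/-- The functional `T` has at `F` and the contamination point `z` the influence function value `v`:
`v = lim_{ε ↓ 0} (T((1 - ε) F + ε δ_z) - T(F)) / ε`. -/
def HasInfluence (T : Measure Ω → H₁) (F : Measure Ω) (z : Ω) (v : H₁) : Prop :=
  Tendsto (fun ε : ℝ => ε⁻¹ • (T (contaminate F z ε) - T F)) (𝓝[>] 0) (𝓝 v)

end Variates

end KCCA

end

open KCCA

/-! Put `A = Σ_UU` and `M = Σ_UV Σ_VV⁻¹ Σ_VU`. The squared canonical correlations are the ordered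
eigenvalues of the symmetric-definite pencil `M - λ A`, and the variates on the side of `U` are its
`A`-normalized eigenvectors. The theorem is therefore first-order perturbation theory of a simple
eigenvalue along the contamination path. Working with the pencil instead of `Σ_UU^{-1/2} M
Σ_UU^{-1/2}` means that no inverse square root has to be differentiated.

Contamination changes every covariance operator by an explicit formula, `Σ_UV ↦ (1 - ε)(Σ_UV + ε u ⊗
v)`, where `u`, `v` are the centered features at the contamination point (`crossCov_contaminate`).
So `A` and `M` become differentiable paths, and `A` stays positive definite. The ordered eigenvalues
vary continuously by a min-max comparison of quadratic forms (`Represents.tendsto_eigenvalue`); this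
guarantees that the `j`-th eigenvalue at `ε` is the perturbation of the `j`-th eigenvalue at `0`.

The perturbation argument (`SimplePerturbation`) rests on one identity. If `L` is the reduced
resolvent and `x` is an eigenvector at `ε`, then `x - ⟪f, A₀ x⟫ f = L (D_ε x)`, where `D_ε → 0` is
the change of the pencil. Smallness of `L D_ε` gives uniqueness and convergence of the eigenvector;
division by `ε` gives its derivative. With `λ` the unperturbed eigenvalue, the outcome is `λ' = ⟪f,
(M' - λ A') f⟫` and, after normalization, `f' = -L (M' - λ A') f - ½ ⟪f, A' f⟫ f`. For a canonical
pair these evaluate to the stated formulas by `explainedDeriv_sub_apply`.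

The side of `Y` is the same result with the two variables exchanged, since an operator and its
adjoint share their singular values (`singularValues_adjoint`). -/

namespace KCCA

/-! ### Spectral functional calculus, inverse square roots and pseudoinverses. -/

section FunctionalCalculus

variable {H : Type*} [NormedAddCommGroup H] [InnerProductSpace ℝ H] [FiniteDimensional ℝ H]

/-- A `finsum` with infinite support would be `0` by default; only eigenvalues contribute, and there
are finitely many. -/
theorem finite_support_symFun (T : H →L[ℝ] H) (φ : ℝ → ℝ) :
    (Function.support fun μ : ℝ =>
      φ μ • (Module.End.eigenspace (T : H →ₗ[ℝ] H) μ).starProjection).Finite := by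
  refine (Module.End.finite_hasEigenvalue (T : H →ₗ[ℝ] H)).subset fun μ hμ => ?_
  by_contra h
  have h0 : Module.End.eigenspace (T : H →ₗ[ℝ] H) μ = ⊥ := by
    simpa [Module.End.hasEigenvalue_iff] using h
  simp [h0] at hμ

/-- Eigenspaces of a symmetric operator are mutually orthogonal, so every projection but the one for
`μ` kills `x`. -/
theorem symFun_apply_of_eigen {T : H →L[ℝ] H} (hT : (T : H →ₗ[ℝ] H).IsSymmetric) (φ : ℝ → ℝ)
    {μ : ℝ} {x : H} (hx : T x = μ • x) : symFun T φ x = φ μ • x := by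
  have h1 : symFun T φ x =
      ∑ᶠ ν : ℝ, (φ ν • (Module.End.eigenspace (T : H →ₗ[ℝ] H) ν).starProjection) x :=
    (ContinuousLinearMap.apply ℝ H x).toLinearMap.toAddMonoidHom.map_finsum
      (finite_support_symFun T φ)
  rw [h1, finsum_eq_single _ μ]
  · have : x ∈ Module.End.eigenspace (T : H →ₗ[ℝ] H) μ := by
      rw [Module.End.mem_eigenspace_iff]; exact hx
    simp [Submodule.starProjection_eq_self_iff.2 this]
  · intro ν hν
    have : x ∈ (Module.End.eigenspace (T : H →ₗ[ℝ] H) ν)ᗮ := by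
      rw [Submodule.mem_orthogonal]
      intro y hy
      rw [Module.End.mem_eigenspace_iff] at hy
      have h2 : ⟪T y, x⟫_ℝ = ⟪y, T x⟫_ℝ := hT y x
      have hy' : T y = ν • y := hy
      rw [hy', hx, inner_smul_left, inner_smul_right] at h2
      have : (ν - μ) * ⟪y, x⟫_ℝ = 0 := by
        simp only [conj_trivial] at h2
        linarith
      rcases mul_eq_zero.1 this with h | h
      · exact absurd (sub_eq_zero.1 h) hν
      · exact h
    simp [(Submodule.starProjection_apply_eq_zero_iff _).2 this]

theorem symFun_isSymmetric (T : H →L[ℝ] H) (φ : ℝ → ℝ) :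
    (symFun T φ : H →ₗ[ℝ] H).IsSymmetric := by
  unfold symFun
  refine finsum_induction (fun S : H →L[ℝ] H => (S : H →ₗ[ℝ] H).IsSymmetric) ?_ ?_ ?_
  · intro x y; simp
  · intro S S' hS hS' x y
    have h1 := hS x y
    have h2 := hS' x y
    simp only [ContinuousLinearMap.coe_coe] at h1 h2
    simp [inner_add_left, inner_add_right, h1, h2]
  · intro μ x y
    simp [inner_smul_left, inner_smul_right, Submodule.inner_starProjection_left_eq_right]

/-- A linear map is determined by its values on the eigenvectors of a symmetric map. -/
theorem apply_eq_of_eigen {T : H →L[ℝ] H} (hT : (T : H →ₗ[ℝ] H).IsSymmetric)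
    {E : Type*} [AddCommGroup E] [Module ℝ E] {S S' : H →ₗ[ℝ] E}
    (h : ∀ (μ : ℝ) (x : H), T x = μ • x → S x = S' x) : S = S' := by
  refine (hT.eigenvectorBasis rfl).toBasis.ext fun i => ?_
  refine h (hT.eigenvalues rfl i) _ ?_
  exact hT.apply_eigenvectorBasis rfl i

theorem invSqrt_isSymmetric (A : H →L[ℝ] H) : (invSqrt A : H →ₗ[ℝ] H).IsSymmetric :=
  symFun_isSymmetric _ _

theorem inner_invSqrt_left (A : H →L[ℝ] H) (x y : H) :
    ⟪invSqrt A x, y⟫_ℝ = ⟪x, invSqrt A y⟫_ℝ :=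
  invSqrt_isSymmetric A x y

omit [FiniteDimensional ℝ H] in
theorem pos_of_eigen {A : H →L[ℝ] H} (hpos : ∀ x, x ≠ 0 → 0 < ⟪x, A x⟫_ℝ) {μ : ℝ} {x : H}
    (hx : A x = μ • x) (h0 : x ≠ 0) : 0 < μ := by
  have := hpos x h0
  rw [hx, inner_smul_right] at this
  exact pos_of_mul_pos_left this real_inner_self_nonneg

theorem invSqrt_apply_apply_apply {A : H →L[ℝ] H} (hA : (A : H →ₗ[ℝ] H).IsSymmetric)
    (hpos : ∀ x, x ≠ 0 → 0 < ⟪x, A x⟫_ℝ) (x : H) : invSqrt A (A (invSqrt A x)) = x := by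
  suffices h : ((invSqrt A ∘L A ∘L invSqrt A : H →L[ℝ] H) : H →ₗ[ℝ] H) = LinearMap.id from
    LinearMap.congr_fun h x
  refine apply_eq_of_eigen hA fun μ x hx => ?_
  rcases eq_or_ne x 0 with rfl | h0
  · simp
  have hμ := pos_of_eigen hpos hx h0
  have h1 : invSqrt A x = (√μ)⁻¹ • x := symFun_apply_of_eigen hA _ hx
  simp only [ContinuousLinearMap.coe_coe, ContinuousLinearMap.comp_apply, h1, hx, map_smul,
    LinearMap.id_apply, smul_smul]
  convert one_smul ℝ x
  have : √μ ≠ 0 := (Real.sqrt_pos.2 hμ).ne'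
  field_simp
  rw [Real.sq_sqrt hμ.le]

theorem invSqrt_apply_invSqrt_apply {A : H →L[ℝ] H} (hA : (A : H →ₗ[ℝ] H).IsSymmetric)
    (hpos : ∀ x, x ≠ 0 → 0 < ⟪x, A x⟫_ℝ) (x : H) : invSqrt A (invSqrt A (A x)) = x := by
  suffices h : ((invSqrt A ∘L invSqrt A ∘L A : H →L[ℝ] H) : H →ₗ[ℝ] H) = LinearMap.id from
    LinearMap.congr_fun h x
  refine apply_eq_of_eigen hA fun μ x hx => ?_
  rcases eq_or_ne x 0 with rfl | h0
  · simp
  have hμ := pos_of_eigen hpos hx h0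
  have h1 : invSqrt A x = (√μ)⁻¹ • x := symFun_apply_of_eigen hA _ hx
  simp only [ContinuousLinearMap.coe_coe, ContinuousLinearMap.comp_apply, h1, hx, map_smul,
    LinearMap.id_apply, smul_smul]
  convert one_smul ℝ x
  have : √μ ≠ 0 := (Real.sqrt_pos.2 hμ).ne'
  field_simp
  rw [Real.sq_sqrt hμ.le]

theorem isUnit_of_pos {A : H →L[ℝ] H} (hpos : ∀ x, x ≠ 0 → 0 < ⟪x, A x⟫_ℝ) : IsUnit A := by
  have hinj : Function.Injective (A : H →ₗ[ℝ] H) := by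
    refine (injective_iff_map_eq_zero _).2 fun x hx => ?_
    by_contra h0
    have := hpos x h0
    have hx' : A x = 0 := hx
    simp [hx'] at this
  rw [ContinuousLinearMap.isUnit_iff_bijective]
  exact ⟨hinj, LinearMap.surjective_of_injective hinj⟩

omit [FiniteDimensional ℝ H] in
theorem inverse_apply_apply {A : H →L[ℝ] H} (hA : IsUnit A) (x : H) :
    Ring.inverse A (A x) = x := by
  have := Ring.inverse_mul_cancel A hA
  exact DFunLike.congr_fun this x

omit [FiniteDimensional ℝ H] in
theorem apply_inverse_apply {A : H →L[ℝ] H} (hA : IsUnit A) (x : H) :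
    A (Ring.inverse A x) = x := by
  have := Ring.mul_inverse_cancel A hA
  exact DFunLike.congr_fun this x

theorem invSqrt_invSqrt_eq_inverse {A : H →L[ℝ] H} (hA : (A : H →ₗ[ℝ] H).IsSymmetric)
    (hpos : ∀ x, x ≠ 0 → 0 < ⟪x, A x⟫_ℝ) (x : H) :
    invSqrt A (invSqrt A x) = Ring.inverse A x := by
  have := invSqrt_apply_invSqrt_apply hA hpos (Ring.inverse A x)
  rwa [apply_inverse_apply (isUnit_of_pos hpos)] at this

/-- The operator `pinv T ∘L T` is the orthogonal projection off the kernel of `T`, which is here the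
line through the unit vector `e`. -/
theorem pinv_apply_apply {T : H →L[ℝ] H} (hT : (T : H →ₗ[ℝ] H).IsSymmetric) {e : H}
    (he : ⟪e, e⟫_ℝ = 1) (hTe : T e = 0) (hker : ∀ x, T x = 0 → ∃ c : ℝ, x = c • e) (x : H) :
    pinv T (T x) = x - ⟪e, x⟫_ℝ • e := by
  suffices h : ((pinv T ∘L T : H →L[ℝ] H) : H →ₗ[ℝ] H) =
      ((ContinuousLinearMap.id ℝ H - (innerSL ℝ e).smulRight e : H →L[ℝ] H) : H →ₗ[ℝ] H) by
    simpa using LinearMap.congr_fun h x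
  refine apply_eq_of_eigen hT fun μ x hx => ?_
  have h1 : pinv T x = μ⁻¹ • x := symFun_apply_of_eigen hT _ hx
  simp only [ContinuousLinearMap.coe_coe, ContinuousLinearMap.comp_apply, hx, map_smul, h1,
    sub_apply, ContinuousLinearMap.id_apply,
    ContinuousLinearMap.smulRight_apply, innerSL_apply_apply]
  rcases eq_or_ne μ 0 with rfl | hμ
  · obtain ⟨c, rfl⟩ := hker x (by simpa using hx)
    simp [inner_smul_right, -inner_self_eq_norm_sq_to_K, he]
  · have h2 : ⟪T e, x⟫_ℝ = ⟪e, T x⟫_ℝ := hT e x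
    rw [hTe, hx, inner_smul_right, inner_zero_left] at h2
    have h3 : ⟪e, x⟫_ℝ = 0 := by simpa [hμ] using h2.symm
    simp [h3, smul_smul, hμ]

theorem pinv_apply_of_ker {T : H →L[ℝ] H} (hT : (T : H →ₗ[ℝ] H).IsSymmetric) {e : H}
    (hTe : T e = 0) : pinv T e = 0 := by
  have h1 : pinv T e = (0 : ℝ)⁻¹ • e := symFun_apply_of_eigen hT _ (by simpa using hTe)
  simpa using h1

end FunctionalCalculus

/-! ### Min-max bounds for the ordered eigenvalues. -/

section MinMax

variable {H : Type*} [NormedAddCommGroup H] [InnerProductSpace ℝ H] [FiniteDimensional ℝ H]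
  {n : ℕ}

theorem inner_apply_eq_sum_eigenvalues {S : H →ₗ[ℝ] H} (hS : S.IsSymmetric)
    (hn : Module.finrank ℝ H = n) (x : H) :
    ⟪x, S x⟫_ℝ = ∑ i, hS.eigenvalues hn i * ⟪hS.eigenvectorBasis hn i, x⟫_ℝ ^ 2 := by
  rw [← (hS.eigenvectorBasis hn).sum_inner_mul_inner x (S x)]
  refine Finset.sum_congr rfl fun i _ => ?_
  rw [← hS, hS.apply_eigenvectorBasis, inner_smul_left, real_inner_comm x]
  simp; ring

omit [FiniteDimensional ℝ H] in
theorem inner_self_eq_sum (b : OrthonormalBasis (Fin n) ℝ H) (x : H) :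
    ⟪x, x⟫_ℝ = ∑ i, ⟪b i, x⟫_ℝ ^ 2 := by
  rw [← b.sum_inner_mul_inner x x]
  refine Finset.sum_congr rfl fun i _ => ?_
  rw [real_inner_comm x]; ring

omit [FiniteDimensional ℝ H] in
theorem inner_eq_zero_of_mem_span (b : OrthonormalBasis (Fin n) ℝ H) (s : Finset (Fin n))
    {w : H} (hw : w ∈ Submodule.span ℝ (Set.range fun i : s => b i)) {i : Fin n} (hi : i ∉ s) :
    ⟪b i, w⟫_ℝ = 0 := by
  induction hw using Submodule.span_induction with
  | mem x hx =>
    obtain ⟨k, rfl⟩ := hx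
    exact b.orthonormal.2 (fun h => hi (h ▸ k.2))
  | zero => simp
  | add x y _ _ hx hy => simp [inner_add_right, hx, hy]
  | smul c x _ hx => simp [inner_smul_right, hx]

omit [FiniteDimensional ℝ H] in
theorem finrank_span_subfamily (b : OrthonormalBasis (Fin n) ℝ H) (s : Finset (Fin n)) :
    Module.finrank ℝ (Submodule.span ℝ (Set.range fun i : s => b i)) = s.card := by
  refine (finrank_span_eq_card
    (b.orthonormal.linearIndependent.comp _ Subtype.val_injective)).trans (by simp)

/-- The span of the eigenvectors numbered `0, …, j` serves, because the eigenvalues decrease. -/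
theorem exists_subspace_eigenvalue_le {S : H →ₗ[ℝ] H} (hS : S.IsSymmetric)
    (hn : Module.finrank ℝ H = n) (j : Fin n) :
    ∃ W : Submodule ℝ H, Module.finrank ℝ W = j + 1 ∧
      ∀ w ∈ W, hS.eigenvalues hn j * ⟪w, w⟫_ℝ ≤ ⟪w, S w⟫_ℝ := by
  refine ⟨_, (finrank_span_subfamily (hS.eigenvectorBasis hn) (Finset.Iic j)).trans (by simp),
    fun w hw => ?_⟩
  rw [inner_apply_eq_sum_eigenvalues hS hn, inner_self_eq_sum (hS.eigenvectorBasis hn),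
    Finset.mul_sum]
  refine Finset.sum_le_sum fun i _ => ?_
  by_cases hi : i ∈ Finset.Iic j
  · exact mul_le_mul_of_nonneg_right (hS.eigenvalues_antitone hn (Finset.mem_Iic.1 hi))
      (sq_nonneg _)
  · simp [inner_eq_zero_of_mem_span _ _ hw hi]

theorem exists_subspace_le_eigenvalue {S : H →ₗ[ℝ] H} (hS : S.IsSymmetric)
    (hn : Module.finrank ℝ H = n) (j : Fin n) :
    ∃ W : Submodule ℝ H, Module.finrank ℝ W = n - j ∧
      ∀ w ∈ W, ⟪w, S w⟫_ℝ ≤ hS.eigenvalues hn j * ⟪w, w⟫_ℝ := by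
  refine ⟨_, (finrank_span_subfamily (hS.eigenvectorBasis hn) (Finset.Ici j)).trans (by simp),
    fun w hw => ?_⟩
  rw [inner_apply_eq_sum_eigenvalues hS hn, inner_self_eq_sum (hS.eigenvectorBasis hn),
    Finset.mul_sum]
  refine Finset.sum_le_sum fun i _ => ?_
  by_cases hi : i ∈ Finset.Ici j
  · exact mul_le_mul_of_nonneg_right (hS.eigenvalues_antitone hn (Finset.mem_Ici.1 hi))
      (sq_nonneg _)
  · simp [inner_eq_zero_of_mem_span _ _ hw hi]

theorem exists_mem_inf_ne_zero (W W' : Submodule ℝ H)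
    (h : Module.finrank ℝ H < Module.finrank ℝ W + Module.finrank ℝ W') :
    ∃ w ∈ W, w ∈ W' ∧ w ≠ 0 := by
  have h1 := Submodule.finrank_sup_add_finrank_inf_eq W W'
  have h2 := Submodule.finrank_le (W ⊔ W')
  have h3 : W ⊓ W' ≠ ⊥ := by
    intro h0
    rw [h0, finrank_bot] at h1
    omega
  obtain ⟨w, hw, h0⟩ := Submodule.exists_mem_ne_zero_of_ne_bot h3
  exact ⟨w, hw.1, hw.2, h0⟩

/-- The dimensions `j + 1` and `n - j` add up to `n + 1`, so `W` meets the span of the eigenvectors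
numbered from `j` on in a nonzero vector; the two bounds are compared there. -/
theorem le_eigenvalue_of_subspace {S : H →ₗ[ℝ] H} (hS : S.IsSymmetric)
    (hn : Module.finrank ℝ H = n) (j : Fin n) {t : ℝ} (W : Submodule ℝ H)
    (hW : Module.finrank ℝ W = j + 1) (h : ∀ w ∈ W, t * ⟪w, w⟫_ℝ ≤ ⟪w, S w⟫_ℝ) :
    t ≤ hS.eigenvalues hn j := by
  obtain ⟨W', hW', h'⟩ := exists_subspace_le_eigenvalue hS hn j
  obtain ⟨w, hw, hw', h0⟩ := exists_mem_inf_ne_zero W W' (by omega)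
  exact le_of_mul_le_mul_right ((h w hw).trans (h' w hw')) (real_inner_self_pos.2 h0)

theorem eigenvalue_le_of_subspace {S : H →ₗ[ℝ] H} (hS : S.IsSymmetric)
    (hn : Module.finrank ℝ H = n) (j : Fin n) {t : ℝ} (W : Submodule ℝ H)
    (hW : Module.finrank ℝ W = n - j) (h : ∀ w ∈ W, ⟪w, S w⟫_ℝ ≤ t * ⟪w, w⟫_ℝ) :
    hS.eigenvalues hn j ≤ t := by
  obtain ⟨W', hW', h'⟩ := exists_subspace_eigenvalue_le hS hn j
  obtain ⟨w, hw, hw', h0⟩ := exists_mem_inf_ne_zero W W' (by omega)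
  exact le_of_mul_le_mul_right ((h' w hw').trans (h w hw)) (real_inner_self_pos.2 h0)

end MinMax

/-! ### Singular values of the adjoint. -/

section AdjointSingularValues

variable {H : Type*} [NormedAddCommGroup H] [InnerProductSpace ℝ H] [FiniteDimensional ℝ H]
  {K : Type*} [NormedAddCommGroup K] [InnerProductSpace ℝ K] [FiniteDimensional ℝ K]

/-- If `W` is spanned by the leading eigenvectors of `T* T`, its image under `T` is a test space for
`T T*`. For `y = T x` with `x` in `W`, Cauchy–Schwarz gives `‖y‖² = ⟪x, T* y⟫ ≤ ‖x‖ ‖T* y‖`, and `σ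
‖x‖² ≤ ‖y‖²` then yields `σ ‖y‖² ≤ ‖T* y‖²`. -/
theorem singularValues_le_adjoint (T : H →ₗ[ℝ] K) {j : ℕ} (hH : j < Module.finrank ℝ H)
    (hK : j < Module.finrank ℝ K) :
    T.singularValues j ≤ (LinearMap.adjoint T).singularValues j := by
  rcases (T.singularValues_nonneg j).eq_or_lt with h0 | h0
  · rw [← h0]; exact LinearMap.singularValues_nonneg _ _
  refine le_of_sq_le_sq ?_ (LinearMap.singularValues_nonneg _ _)
  have hs := T.sq_singularValues_of_lt rfl hH
  rw [(LinearMap.adjoint T).sq_singularValues_of_lt rfl hK]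
  obtain ⟨W, hW, h⟩ := exists_subspace_eigenvalue_le T.isSymmetric_adjoint_comp_self rfl ⟨j, hH⟩
  rw [← hs] at h
  set σ := T.singularValues j ^ 2 with hσ
  have hσ0 : 0 < σ := by positivity
  have hb : ∀ w ∈ W, σ * ⟪w, w⟫_ℝ ≤ ⟪T w, T w⟫_ℝ := by
    intro w hw
    have := h w hw
    rwa [LinearMap.comp_apply, LinearMap.adjoint_inner_right] at this
  -- Positivity of `σ` is what keeps the image of `W` at dimension `j + 1`; this is why a zero
  -- singular value was split off.
  have hinj : Function.Injective (T.domRestrict W) := by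
    refine (injective_iff_map_eq_zero _).2 fun w hw => ?_
    have h1 := hb w w.2
    have h2 : T w = 0 := hw
    rw [h2, inner_zero_left] at h1
    by_contra hne
    have : 0 < ⟪(w : H), (w : H)⟫_ℝ := real_inner_self_pos.2 (by simpa using hne)
    nlinarith
  refine le_eigenvalue_of_subspace _ _ _ (LinearMap.range (T.domRestrict W)) ?_ ?_
  · rw [LinearMap.finrank_range_of_inj hinj, hW]
  · rintro _ ⟨w, rfl⟩
    have h1 := hb w w.2
    set x : H := (w : H)
    have h3 : ⟪T x, (LinearMap.adjoint (LinearMap.adjoint T) ∘ₗ LinearMap.adjoint T) (T x)⟫_ℝ =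
        ⟪LinearMap.adjoint T (T x), LinearMap.adjoint T (T x)⟫_ℝ := by
      rw [LinearMap.comp_apply, LinearMap.adjoint_inner_right]
    change σ * ⟪T x, T x⟫_ℝ ≤ _
    refine le_of_le_of_eq ?_ h3.symm
    have h4 : ⟪T x, T x⟫_ℝ ≤ ‖x‖ * ‖LinearMap.adjoint T (T x)‖ := by
      rw [← LinearMap.adjoint_inner_right]
      exact real_inner_le_norm _ _
    rw [real_inner_self_eq_norm_sq] at h1 h4 ⊢
    rw [real_inner_self_eq_norm_sq] at h1 ⊢
    rcases (norm_nonneg (T x)).eq_or_lt with h5 | h5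
    · rw [← h5]; simp
    have h6 : (‖T x‖ ^ 2) ^ 2 ≤ ‖x‖ ^ 2 * ‖LinearMap.adjoint T (T x)‖ ^ 2 := by
      rw [← mul_pow]; gcongr
    have h7 : σ * (‖T x‖ ^ 2 * ‖T x‖ ^ 2) ≤ ‖LinearMap.adjoint T (T x)‖ ^ 2 * ‖T x‖ ^ 2 := by
      calc σ * (‖T x‖ ^ 2 * ‖T x‖ ^ 2) ≤ σ * (‖x‖ ^ 2 * ‖LinearMap.adjoint T (T x)‖ ^ 2) := by
            rw [← sq]; gcongr
        _ = ‖LinearMap.adjoint T (T x)‖ ^ 2 * (σ * ‖x‖ ^ 2) := by ring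
        _ ≤ _ := by gcongr
    rw [← mul_assoc] at h7
    exact le_of_mul_le_mul_right h7 (by positivity)

theorem singularValues_adjoint (T : H →ₗ[ℝ] K) {j : ℕ} (hH : j < Module.finrank ℝ H)
    (hK : j < Module.finrank ℝ K) :
    (LinearMap.adjoint T).singularValues j = T.singularValues j := by
  refine le_antisymm ?_ (singularValues_le_adjoint T hH hK)
  simpa using singularValues_le_adjoint (LinearMap.adjoint T) hK hH

end AdjointSingularValues

/-! ### Symmetric-definite pencils and continuity of their eigenvalues. -/

section Pencil

variable {H : Type*} [NormedAddCommGroup H] [InnerProductSpace ℝ H] [FiniteDimensional ℝ H]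
  {n : ℕ}

/-- `S` represents the symmetric pencil `M - t A` in the coordinates given by `R = A^{-1/2}`. -/
structure Represents (A M R S : H →L[ℝ] H) : Prop where
  symm_R : ∀ x y, ⟪R x, y⟫_ℝ = ⟪x, R y⟫_ℝ
  RAR : ∀ x, R (A (R x)) = x
  symm_S : (S : H →ₗ[ℝ] H).IsSymmetric
  eq : ∀ x, S x = R (M (R x))

namespace Represents

variable {A M R S A' M' R' S' : H →L[ℝ] H}

omit [FiniteDimensional ℝ H] in
theorem inner_S (h : Represents A M R S) (w : H) : ⟪w, S w⟫_ℝ = ⟪R w, M (R w)⟫_ℝ := by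
  rw [h.eq, ← h.symm_R]

omit [FiniteDimensional ℝ H] in
theorem inner_self (h : Represents A M R S) (w : H) : ⟪w, w⟫_ℝ = ⟪R w, A (R w)⟫_ℝ := by
  rw [h.symm_R, h.RAR]

omit [FiniteDimensional ℝ H] in
theorem R_injective (h : Represents A M R S) : Function.Injective R := by
  intro x y hxy
  rw [← h.RAR x, hxy, h.RAR]

/-- In finite dimension the injective `R` is surjective, so `R A R = 1` can be rearranged to `R R A
= 1`. -/
theorem R_apply_A_R (h : Represents A M R S) (x : H) : R (R (A x)) = x := by
  obtain ⟨y, rfl⟩ := LinearMap.surjective_of_injective (f := (R : H →ₗ[ℝ] H)) h.R_injective x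
  exact congrArg R (h.RAR y)

theorem R_surjective (h : Represents A M R S) (x : H) : ∃ y, R y = x :=
  ⟨R (A x), h.R_apply_A_R x⟩

/-- The subspace which represents, for a second pencil, the same vectors as `W` for the first. -/
theorem exists_transport (h : Represents A M R S) (h' : Represents A' M' R' S')
    (W : Submodule ℝ H) : ∃ W' : Submodule ℝ H, Module.finrank ℝ W' = Module.finrank ℝ W ∧
      ∀ w' ∈ W', ∃ w ∈ W, R w = R' w' := by
  let φ : H →ₗ[ℝ] H := (R' : H →ₗ[ℝ] H) ∘ₗ (A' : H →ₗ[ℝ] H) ∘ₗ (R : H →ₗ[ℝ] H)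
  have hφ : ∀ w, R' (φ w) = R w := fun w => h'.R_apply_A_R (R w)
  have hinj : Function.Injective φ := fun x y hxy =>
    h.R_injective (by rw [← hφ, hxy, hφ])
  refine ⟨W.map φ, (Submodule.equivMapOfInjective φ hinj W).finrank_eq.symm, ?_⟩
  rintro _ ⟨w, hw, rfl⟩
  exact ⟨w, hw, (hφ w).symm⟩

/-- On the leading subspace `M - t A ≥ η A`, so `hη` makes `M' - t A'` nonnegative on the same
vectors. Transporting them to the coordinates of the second pencil preserves the dimension, and
min-max applies. -/
theorem le_eigenvalue (h : Represents A M R S) (h' : Represents A' M' R' S')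
    (hn : Module.finrank ℝ H = n) (j : Fin n) {t η : ℝ}
    (hη : ∀ x, ⟪x, M x⟫_ℝ - t * ⟪x, A x⟫_ℝ ≤
      ⟪x, M' x⟫_ℝ - t * ⟪x, A' x⟫_ℝ + η * ⟪x, A x⟫_ℝ)
    (ht : t + η ≤ h.symm_S.eigenvalues hn j) : t ≤ h'.symm_S.eigenvalues hn j := by
  obtain ⟨W, hW, hb⟩ := exists_subspace_eigenvalue_le h.symm_S hn j
  obtain ⟨W', hW', hb'⟩ := h.exists_transport h' W
  refine le_eigenvalue_of_subspace _ hn j W' (hW'.trans hW) fun w' hw' => ?_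
  obtain ⟨w, hw, hww⟩ := hb' w' hw'
  have h1 := hb w hw
  simp only [ContinuousLinearMap.coe_coe] at h1 ⊢
  have h2 := mul_le_mul_of_nonneg_right ht (real_inner_self_nonneg (x := w))
  rw [h.inner_S, h.inner_self] at h1
  rw [h.inner_self] at h2
  rw [h'.inner_S, h'.inner_self, ← hww]
  have h3 := hη (R w)
  linarith

theorem eigenvalue_le (h : Represents A M R S) (h' : Represents A' M' R' S')
    (hn : Module.finrank ℝ H = n) (j : Fin n) {t η : ℝ}
    (hη : ∀ x, ⟪x, M' x⟫_ℝ - t * ⟪x, A' x⟫_ℝ ≤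
      ⟪x, M x⟫_ℝ - t * ⟪x, A x⟫_ℝ + η * ⟪x, A x⟫_ℝ)
    (ht : h.symm_S.eigenvalues hn j ≤ t - η) : h'.symm_S.eigenvalues hn j ≤ t := by
  obtain ⟨W, hW, hb⟩ := exists_subspace_le_eigenvalue h.symm_S hn j
  obtain ⟨W', hW', hb'⟩ := h.exists_transport h' W
  refine eigenvalue_le_of_subspace _ hn j W' (hW'.trans hW) fun w' hw' => ?_
  obtain ⟨w, hw, hww⟩ := hb' w' hw'
  have h1 := hb w hw
  simp only [ContinuousLinearMap.coe_coe] at h1 ⊢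
  have h2 := mul_le_mul_of_nonneg_right ht (real_inner_self_nonneg (x := w))
  rw [h.inner_S, h.inner_self] at h1
  rw [h.inner_self] at h2
  rw [h'.inner_S, h'.inner_self, ← hww]
  have h3 := hη (R w)
  linarith

/-- Bounds a perturbation relative to the form of `A`, as the comparison lemmas require. -/
theorem abs_inner_le (h : Represents A M R S) (D : H →L[ℝ] H) (x : H) :
    |⟪x, D x⟫_ℝ| ≤ ‖D‖ * ‖R‖ ^ 2 * ⟪x, A x⟫_ℝ := by
  obtain ⟨w, rfl⟩ := h.R_surjective x
  rw [← h.inner_self, real_inner_self_eq_norm_sq]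
  have h1 : ‖R w‖ ≤ ‖R‖ * ‖w‖ := R.le_opNorm w
  calc |⟪R w, D (R w)⟫_ℝ| ≤ ‖R w‖ * ‖D (R w)‖ := abs_real_inner_le_norm _ _
    _ ≤ ‖R w‖ * (‖D‖ * ‖R w‖) := by gcongr; exact D.le_opNorm _
    _ = ‖D‖ * ‖R w‖ ^ 2 := by ring
    _ ≤ ‖D‖ * (‖R‖ * ‖w‖) ^ 2 := by gcongr
    _ = _ := by ring

/-- The ordered eigenvalues of a symmetric-definite pencil depend continuously on the pencil. -/
theorem tendsto_eigenvalue {ι : Type*} {l : Filter ι} (h : Represents A M R S)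
    {Aε Mε Rε Sε : ι → H →L[ℝ] H} (hA : Tendsto Aε l (𝓝 A)) (hM : Tendsto Mε l (𝓝 M))
    (hn : Module.finrank ℝ H = n) (j : Fin n) {lam : ι → ℝ}
    (hlam : ∀ᶠ i in l, ∃ hi : Represents (Aε i) (Mε i) (Rε i) (Sε i),
      lam i = hi.symm_S.eigenvalues hn j) :
    Tendsto lam l (𝓝 (h.symm_S.eigenvalues hn j)) := by
  -- Only the forms of `Aε` and `Mε` are compared with those of `A` and `M`; no convergence of `Rε`
  -- or `Sε` is needed.
  have key : ∀ t η : ℝ, 0 < η → ∀ᶠ i in l, ∀ x,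
      |⟪x, ((Mε i - M) - t • (Aε i - A)) x⟫_ℝ| ≤ η * ⟪x, A x⟫_ℝ := by
    intro t η hη
    have h1 : Tendsto (fun i => ‖(Mε i - M) - t • (Aε i - A)‖ * ‖R‖ ^ 2) l (𝓝 0) := by
      have : Tendsto (fun i => ‖(Mε i - M) - t • (Aε i - A)‖ * ‖R‖ ^ 2) l
          (𝓝 (‖(M - M) - t • (A - A)‖ * ‖R‖ ^ 2)) :=
        (((hM.sub_const M).sub ((hA.sub_const A).const_smul t)).norm).mul_const _
      simpa using this
    filter_upwards [h1.eventually (gt_mem_nhds hη)] with i hi x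
    refine (h.abs_inner_le _ x).trans ?_
    have : 0 ≤ ⟪x, A x⟫_ℝ := by
      obtain ⟨w, rfl⟩ := h.R_surjective x
      rw [← h.inner_self]; exact real_inner_self_nonneg
    gcongr
  refine tendsto_order.2 ⟨fun t ht => ?_, fun t ht => ?_⟩
  -- The comparison lemma gives only a weak inequality, so it is applied at an intermediate `s`,
  -- with `η` the gap from `s` to the limit eigenvalue.
  · obtain ⟨s, hts, hs⟩ := exists_between ht
    filter_upwards [key s _ (sub_pos.2 hs), hlam] with i hi ⟨hr, hl⟩
    rw [hl]
    refine hts.trans_le (h.le_eigenvalue hr hn j (η := h.symm_S.eigenvalues hn j - s)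
      (fun x => ?_) (by linarith))
    have := neg_le_of_abs_le (hi x)
    simp only [sub_apply, smul_apply, inner_sub_right,
      inner_smul_right] at this
    linarith
  · obtain ⟨s, hs, hts⟩ := exists_between ht
    filter_upwards [key s _ (sub_pos.2 hs), hlam] with i hi ⟨hr, hl⟩
    rw [hl]
    refine (h.eigenvalue_le hr hn j (η := s - h.symm_S.eigenvalues hn j)
      (fun x => ?_) (by linarith)).trans_lt hts
    have := le_of_abs_le (hi x)
    simp only [sub_apply, smul_apply, inner_sub_right,
      inner_smul_right] at this
    linarith

end Represents

end Pencil

/-! ### One-sided perturbation of a simple eigenvalue. -/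

theorem tendsto_clm_apply {ι E G : Type*} [NormedAddCommGroup E] [NormedSpace ℝ E]
    [NormedAddCommGroup G] [NormedSpace ℝ G] {l : Filter ι} {T : ι → E →L[ℝ] G} {T₀ : E →L[ℝ] G}
    {x : ι → E} {x₀ : E} (hT : Tendsto T l (𝓝 T₀)) (hx : Tendsto x l (𝓝 x₀)) :
    Tendsto (fun i => T i (x i)) l (𝓝 (T₀ x₀)) :=
  (isBoundedBilinearMap_apply.continuous.tendsto (T₀, x₀)).comp (hT.prodMk_nhds hx)

/-- One-sided first-order perturbation data for a simple eigenvalue of a symmetric pencil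
`M - λ A`. The operator `L` is the reduced resolvent of the unperturbed pencil at the eigenpair
`(lam 0, f)`. -/
structure SimplePerturbation {E : Type*} [NormedAddCommGroup E] [InnerProductSpace ℝ E]
    (A M : ℝ → E →L[ℝ] E) (A' M' L : E →L[ℝ] E) (lam : ℝ → ℝ) (f : E) : Prop where
  hasDeriv_A : HasDerivWithinAt A A' (Set.Ioi 0) 0
  hasDeriv_M : HasDerivWithinAt M M' (Set.Ioi 0) 0
  tendsto_lam : Tendsto lam (𝓝[>] 0) (𝓝 (lam 0))
  exists_eigen : ∀ᶠ ε in 𝓝[>] (0 : ℝ), ∃ h : E, h ≠ 0 ∧ M ε h = lam ε • A ε h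
  pos_A : ∀ᶠ ε in 𝓝[>] (0 : ℝ), ∀ x : E, x ≠ 0 → 0 < ⟪x, A ε x⟫_ℝ
  symm_A : ∀ x y, ⟪A 0 x, y⟫_ℝ = ⟪x, A 0 y⟫_ℝ
  symm_M : ∀ x y, ⟪M 0 x, y⟫_ℝ = ⟪x, M 0 y⟫_ℝ
  eigen : M 0 f = lam 0 • A 0 f
  norm_f : ⟪f, A 0 f⟫_ℝ = 1
  resolvent : ∀ h, L (M 0 h - lam 0 • A 0 h) = h - ⟪f, A 0 h⟫_ℝ • f
  resolvent_f : L (A 0 f) = 0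

namespace SimplePerturbation

variable {E : Type*} [NormedAddCommGroup E] [InnerProductSpace ℝ E]
  {A M : ℝ → E →L[ℝ] E} {A' M' L : E →L[ℝ] E} {lam : ℝ → ℝ} {f : E}

/-- The change `(M₀ - λ₀ A₀) - (M_ε - λ_ε A_ε)` of the pencil. -/
def defect (A M : ℝ → E →L[ℝ] E) (lam : ℝ → ℝ) (ε : ℝ) : E →L[ℝ] E :=
  (M 0 - lam 0 • A 0) - (M ε - lam ε • A ε)

theorem tendsto_A (h : SimplePerturbation A M A' M' L lam f) :
    Tendsto A (𝓝[>] 0) (𝓝 (A 0)) :=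
  h.hasDeriv_A.continuousWithinAt

theorem tendsto_M (h : SimplePerturbation A M A' M' L lam f) :
    Tendsto M (𝓝[>] 0) (𝓝 (M 0)) :=
  h.hasDeriv_M.continuousWithinAt

theorem tendsto_defect (h : SimplePerturbation A M A' M' L lam f) :
    Tendsto (defect A M lam) (𝓝[>] 0) (𝓝 0) := by
  have : Tendsto (defect A M lam) (𝓝[>] 0)
      (𝓝 ((M 0 - lam 0 • A 0) - (M 0 - lam 0 • A 0))) :=
    tendsto_const_nhds.sub (h.tendsto_M.sub (h.tendsto_lam.smul h.tendsto_A))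
  simpa using this

/-- On an eigenvector at `ε` the perturbed pencil vanishes, so the defect acts as the unperturbed
pencil, which `L` inverts modulo `f`. -/
theorem eq_resolvent_defect (h : SimplePerturbation A M A' M' L lam f) {ε : ℝ} {x : E}
    (hx : M ε x = lam ε • A ε x) :
    x - ⟪f, A 0 x⟫_ℝ • f = L (defect A M lam ε x) := by
  rw [← h.resolvent]
  simp [defect, hx]

theorem eventually_defect_small (h : SimplePerturbation A M A' M' L lam f) :
    ∀ᶠ ε in 𝓝[>] (0 : ℝ), ‖L‖ * ‖defect A M lam ε‖ < 1 / 2 := by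
  have : Tendsto (fun ε => ‖L‖ * ‖defect A M lam ε‖) (𝓝[>] 0) (𝓝 0) := by
    simpa using h.tendsto_defect.norm.const_mul ‖L‖
  exact this.eventually (gt_mem_nhds (by norm_num))

theorem norm_sub_le (h : SimplePerturbation A M A' M' L lam f) {ε : ℝ} {x : E}
    (hx : M ε x = lam ε • A ε x) :
    ‖x - ⟪f, A 0 x⟫_ℝ • f‖ ≤ ‖L‖ * ‖defect A M lam ε‖ * ‖x‖ := by
  rw [h.eq_resolvent_defect hx, mul_assoc]
  exact (L.le_opNorm _).trans (by gcongr; exact ContinuousLinearMap.le_opNorm _ _)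

/-- A perturbed eigenvector is determined by its component along `f`. -/
theorem eventually_injective (h : SimplePerturbation A M A' M' L lam f) :
    ∀ᶠ ε in 𝓝[>] (0 : ℝ), ∀ x, M ε x = lam ε • A ε x → ⟪f, A 0 x⟫_ℝ = 0 → x = 0 := by
  filter_upwards [h.eventually_defect_small] with ε hε x hx h0
  have h1 := h.norm_sub_le hx
  rw [h0, zero_smul, sub_zero] at h1
  have h2 : ‖L‖ * ‖defect A M lam ε‖ * ‖x‖ ≤ 1 / 2 * ‖x‖ := by gcongr
  have h3 := norm_nonneg x
  exact norm_eq_zero.1 (by linarith)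

/-- The perturbed eigenvectors, normalized to have component `1` along `f`. -/
theorem exists_branch (h : SimplePerturbation A M A' M' L lam f) :
    ∃ k : ℝ → E, k 0 = f ∧ ∀ᶠ ε in 𝓝[>] (0 : ℝ),
      M ε (k ε) = lam ε • A ε (k ε) ∧ ⟪f, A 0 (k ε)⟫_ℝ = 1 := by
  have h1 : ∀ᶠ ε in 𝓝[>] (0 : ℝ), ∃ x, M ε x = lam ε • A ε x ∧ ⟪f, A 0 x⟫_ℝ = 1 := by
    filter_upwards [h.exists_eigen, h.eventually_injective] with ε ⟨x, hx0, hx⟩ hinj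
    have hc : ⟪f, A 0 x⟫_ℝ ≠ 0 := fun hc => hx0 (hinj x hx hc)
    refine ⟨(⟪f, A 0 x⟫_ℝ)⁻¹ • x, ?_, ?_⟩
    · rw [map_smul, map_smul, hx, smul_comm]
    · rw [map_smul, inner_smul_right, inv_mul_cancel₀ hc]
  obtain ⟨k, hk⟩ := h1.choice
  -- The derivative at `0` involves the value at `0`, which the choice over `ε > 0` leaves free.
  refine ⟨Function.update k 0 f, by simp, ?_⟩
  filter_upwards [hk, self_mem_nhdsWithin] with ε hε hpos
  rwa [Function.update_of_ne (ne_of_gt hpos)]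

section Branch

variable {k : ℝ → E}

/-- Since `‖L‖ ‖D_ε‖ < 1/2`, the bound `‖k - f‖ ≤ ½ ‖k‖` first gives `‖k‖ ≤ 2 ‖f‖`; inserting this
in the sharper bound gives convergence. -/
theorem tendsto_branch (h : SimplePerturbation A M A' M' L lam f)
    (hk : ∀ᶠ ε in 𝓝[>] (0 : ℝ), M ε (k ε) = lam ε • A ε (k ε) ∧ ⟪f, A 0 (k ε)⟫_ℝ = 1) :
    Tendsto k (𝓝[>] 0) (𝓝 f) := by
  rw [tendsto_iff_norm_sub_tendsto_zero]
  have h1 : Tendsto (fun ε => ‖L‖ * ‖defect A M lam ε‖ * (2 * ‖f‖)) (𝓝[>] 0) (𝓝 0) := by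
    simpa using (h.tendsto_defect.norm.const_mul ‖L‖).mul_const (2 * ‖f‖)
  refine squeeze_zero' (Eventually.of_forall fun _ => norm_nonneg _) ?_ h1
  filter_upwards [hk, h.eventually_defect_small] with ε ⟨he, hc⟩ hs
  have h2 := h.norm_sub_le he
  rw [hc, one_smul] at h2
  refine h2.trans ?_
  have h3 : ‖L‖ * ‖defect A M lam ε‖ * ‖k ε‖ ≤ 1 / 2 * ‖k ε‖ := by gcongr
  have h4 : ‖k ε‖ ≤ ‖f‖ + ‖k ε - f‖ := by
    simpa using norm_add_le f (k ε - f)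
  gcongr
  linarith

theorem tendsto_inv_smul_lam (h : SimplePerturbation A M A' M' L lam f)
    (hk : ∀ᶠ ε in 𝓝[>] (0 : ℝ), M ε (k ε) = lam ε • A ε (k ε) ∧ ⟪f, A 0 (k ε)⟫_ℝ = 1) :
    Tendsto (fun ε => ε⁻¹ • (lam ε - lam 0)) (𝓝[>] 0) (𝓝 ⟪f, M' f - lam 0 • A' f⟫_ℝ) := by
  have hMd := (hasDerivWithinAt_iff_tendsto_slope' (by simp)).1 h.hasDeriv_M
  have hAd := (hasDerivWithinAt_iff_tendsto_slope' (by simp)).1 h.hasDeriv_A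
  have hkt := h.tendsto_branch hk
  -- Pairing with `f` turns the difference quotients of the pencil at `k ε` into exactly `(lam ε -
  -- lam 0) / ε`: symmetry and the normalization of `k ε` give `⟪f, M 0 (k ε)⟫ = lam 0`, and the
  -- terms at `ε` cancel.
  have h1 : Tendsto (fun ε => ⟪f, slope M 0 ε (k ε) - lam ε • slope A 0 ε (k ε)⟫_ℝ) (𝓝[>] 0)
      (𝓝 ⟪f, M' f - lam 0 • A' f⟫_ℝ) :=
    tendsto_const_nhds.inner
      ((tendsto_clm_apply hMd hkt).sub (h.tendsto_lam.smul (tendsto_clm_apply hAd hkt)))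
  refine h1.congr' ?_
  filter_upwards [hk] with ε ⟨he, hc⟩
  have h2 : ⟪f, M 0 (k ε)⟫_ℝ = lam 0 := by
    rw [← h.symm_M, h.eigen, inner_smul_left, h.symm_A, hc]; simp
  simp only [slope_def_module, smul_apply, sub_apply, inner_sub_right, inner_smul_right, he, hc,
    h2, sub_zero, smul_eq_mul]
  ring

theorem hasDeriv_lam (h : SimplePerturbation A M A' M' L lam f)
    (hk : ∀ᶠ ε in 𝓝[>] (0 : ℝ), M ε (k ε) = lam ε • A ε (k ε) ∧ ⟪f, A 0 (k ε)⟫_ℝ = 1) :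
    HasDerivWithinAt lam ⟪f, M' f - lam 0 • A' f⟫_ℝ (Set.Ioi 0) 0 := by
  rw [hasDerivWithinAt_iff_tendsto_slope' (by simp)]
  exact (h.tendsto_inv_smul_lam hk).congr fun ε => by simp [slope_def_module]

theorem hasDeriv_branch (h : SimplePerturbation A M A' M' L lam f) (h0 : k 0 = f)
    (hk : ∀ᶠ ε in 𝓝[>] (0 : ℝ), M ε (k ε) = lam ε • A ε (k ε) ∧ ⟪f, A 0 (k ε)⟫_ℝ = 1) :
    HasDerivWithinAt k (-L (M' f - lam 0 • A' f)) (Set.Ioi 0) 0 := by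
  have hD := (h.hasDeriv_M.const_sub (M 0)).add
    (((h.hasDeriv_lam hk).smul h.hasDeriv_A).sub_const (lam 0 • A 0))
  have hDs := (hasDerivWithinAt_iff_tendsto_slope' (by simp)).1 hD
  have h1 := (L.continuous.tendsto _).comp (tendsto_clm_apply hDs (h.tendsto_branch hk))
  rw [hasDerivWithinAt_iff_tendsto_slope' (by simp)]
  -- The contribution of the derivative of `lam` is a multiple of `L (A 0 f) = 0`.
  have h2 : L ((-M' + (lam 0 • A' + ⟪f, M' f - lam 0 • A' f⟫_ℝ • A 0)) f) =
      -L (M' f - lam 0 • A' f) := by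
    simp [h.resolvent_f]
    abel
  rw [h2] at h1
  refine h1.congr' ?_
  filter_upwards [hk] with ε ⟨he, hc⟩
  have h3 := h.eq_resolvent_defect he
  rw [hc, one_smul] at h3
  simp only [Function.comp_apply, slope_def_module, h0, h3, defect, smul_apply, map_smul, sub_zero]
  congr 2
  simp
  abel

theorem hasDeriv_normalized (h : SimplePerturbation A M A' M' L lam f) (h0 : k 0 = f)
    (hk : ∀ᶠ ε in 𝓝[>] (0 : ℝ), M ε (k ε) = lam ε • A ε (k ε) ∧ ⟪f, A 0 (k ε)⟫_ℝ = 1) :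
    HasDerivWithinAt (fun ε => (√⟪k ε, A ε (k ε)⟫_ℝ)⁻¹ • k ε)
      (-L (M' f - lam 0 • A' f) - (1 / 2 * ⟪f, A' f⟫_ℝ) • f) (Set.Ioi 0) 0 := by
  have hkd := h.hasDeriv_branch h0 hk
  set k' := -L (M' f - lam 0 • A' f)
  -- The quantity `⟪f, A 0 (k ε)⟫` is constantly `1`. Hence the squared length has derivative `⟪f,
  -- A' f⟫` alone, and its inverse root contributes the factor `-1/2`.
  have h1 : ⟪f, A 0 k'⟫_ℝ = 0 := by
    have hd : HasDerivWithinAt (fun ε => (innerSL ℝ f ∘L A 0) (k ε)) ((innerSL ℝ f ∘L A 0) k')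
        (Set.Ioi 0) 0 := (innerSL ℝ f ∘L A 0).hasFDerivAt.comp_hasDerivWithinAt 0 hkd
    have hd' : HasDerivWithinAt (fun ε => (innerSL ℝ f ∘L A 0) (k ε)) 0 (Set.Ioi 0) 0 := by
      refine (hasDerivWithinAt_const (0 : ℝ) (Set.Ioi 0) (1 : ℝ)).congr_of_eventuallyEq ?_ ?_
      · filter_upwards [hk] with ε hε using by simpa using hε.2
      · simpa [h0] using h.norm_f
    have := (uniqueDiffWithinAt_Ioi (0 : ℝ)).eq_deriv _ hd hd'
    simpa using this
  have hr : HasDerivWithinAt (fun ε => ⟪k ε, A ε (k ε)⟫_ℝ) ⟪f, A' f⟫_ℝ (Set.Ioi 0) 0 := by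
    have := hkd.inner ℝ (h.hasDeriv_A.clm_apply hkd)
    refine this.congr_deriv ?_
    have h2 : ⟪k', A 0 f⟫_ℝ = 0 := by rw [← h.symm_A, real_inner_comm, h1]
    rw [h0, inner_add_right, h1, h2, add_zero, add_zero]
  have hr0 : ⟪k 0, A 0 (k 0)⟫_ℝ = 1 := by rw [h0, h.norm_f]
  have hs := ((hr.sqrt (by rw [hr0]; norm_num)).fun_inv (by rw [hr0]; norm_num)).smul hkd
  refine hs.congr_deriv ?_
  rw [hr0, h0]
  simp only [Real.sqrt_one, inv_one, one_smul]
  rw [sub_eq_add_neg, ← neg_smul]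
  congr 2
  ring

/-- The normalized perturbed eigenvectors on the side of `f` are the normalized branch. -/
theorem eventually_variate_iff (h : SimplePerturbation A M A' M' L lam f)
    (hk : ∀ᶠ ε in 𝓝[>] (0 : ℝ), M ε (k ε) = lam ε • A ε (k ε) ∧ ⟪f, A 0 (k ε)⟫_ℝ = 1) :
    ∀ᶠ ε in 𝓝[>] (0 : ℝ), ∀ x,
      ((M ε x = lam ε • A ε x ∧ ⟪x, A ε x⟫_ℝ = 1) ∧ 0 < ⟪x, A 0 f⟫_ℝ) ↔
        x = (√⟪k ε, A ε (k ε)⟫_ℝ)⁻¹ • k ε := by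
  filter_upwards [hk, h.eventually_injective, h.pos_A] with ε ⟨he, hc⟩ hinj hpos x
  have hk0 : k ε ≠ 0 := fun h0 => by simp [h0] at hc
  have hr := hpos _ hk0
  have hs := Real.sqrt_pos.2 hr
  have hsq := Real.sq_sqrt hr.le
  set r := ⟪k ε, A ε (k ε)⟫_ℝ
  have hcomm : ∀ y, ⟪y, A 0 f⟫_ℝ = ⟪f, A 0 y⟫_ℝ := fun y => by
    rw [← h.symm_A, real_inner_comm]
  constructor
  · rintro ⟨⟨hx, hn⟩, hp⟩
    rw [hcomm] at hp
    set c := ⟪f, A 0 x⟫_ℝ with hcdef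
    -- This difference is again an eigenvector at `ε` and has no component along `f`. Unit length
    -- then fixes `c` up to sign, and positivity of `c` fixes the sign.
    have h1 : x - c • k ε = 0 := by
      refine hinj _ ?_ ?_
      · simp only [map_sub, map_smul, hx, he, smul_sub]
        rw [smul_comm c]
      · simp only [map_sub, map_smul, inner_sub_right, inner_smul_right, hc]
        simp [c]
    have h2 : x = c • k ε := sub_eq_zero.1 h1
    rw [h2, map_smul, inner_smul_left, inner_smul_right] at hn
    have h3 : c * (c * r) = 1 := by simpa using hn
    have h4 : c * √r = 1 := by
      have : (c * √r) ^ 2 = 1 := by rw [mul_pow, hsq]; linarith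
      exact (pow_eq_one_iff_of_nonneg (mul_pos hp hs).le two_ne_zero).1 this
    rw [h2, eq_inv_of_mul_eq_one_left h4]
  · rintro rfl
    refine ⟨⟨?_, ?_⟩, ?_⟩
    · rw [map_smul, map_smul, he, smul_comm]
    · rw [map_smul, inner_smul_left, inner_smul_right]
      change (√r)⁻¹ * ((√r)⁻¹ * r) = 1
      field_simp
      exact hsq.symm
    · rw [hcomm, map_smul, inner_smul_right, hc, mul_one]
      exact inv_pos.2 hs

end Branch

theorem tendsto_lam_slope (h : SimplePerturbation A M A' M' L lam f) :
    Tendsto (fun ε => ε⁻¹ • (lam ε - lam 0)) (𝓝[>] 0) (𝓝 ⟪f, M' f - lam 0 • A' f⟫_ℝ) :=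
  let ⟨_, _, hk⟩ := h.exists_branch
  h.tendsto_inv_smul_lam hk

theorem eventually_existsUnique (h : SimplePerturbation A M A' M' L lam f) :
    ∀ᶠ ε in 𝓝[>] (0 : ℝ), ∃! x,
      (M ε x = lam ε • A ε x ∧ ⟪x, A ε x⟫_ℝ = 1) ∧ 0 < ⟪x, A 0 f⟫_ℝ := by
  obtain ⟨k, -, hk⟩ := h.exists_branch
  filter_upwards [h.eventually_variate_iff hk] with ε hε
  exact ⟨_, (hε _).2 rfl, fun y hy => (hε y).1 hy⟩

theorem tendsto_variate_slope (h : SimplePerturbation A M A' M' L lam f) {v : ℝ → E}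
    (hv0 : v 0 = f) (hv : ∀ᶠ ε in 𝓝[>] (0 : ℝ),
      (M ε (v ε) = lam ε • A ε (v ε) ∧ ⟪v ε, A ε (v ε)⟫_ℝ = 1) ∧ 0 < ⟪v ε, A 0 f⟫_ℝ) :
    Tendsto (fun ε => ε⁻¹ • (v ε - v 0)) (𝓝[>] 0)
      (𝓝 (-L (M' f - lam 0 • A' f) - (1 / 2 * ⟪f, A' f⟫_ℝ) • f)) := by
  obtain ⟨k, h0, hk⟩ := h.exists_branch
  have h1 : HasDerivWithinAt v (-L (M' f - lam 0 • A' f) - (1 / 2 * ⟪f, A' f⟫_ℝ) • f)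
      (Set.Ioi 0) 0 := by
    refine (h.hasDeriv_normalized h0 hk).congr_of_eventuallyEq ?_ ?_
    · filter_upwards [hv, h.eventually_variate_iff hk] with ε hε hiff using (hiff _).1 hε
    · simp [h0, h.norm_f, hv0]
  rw [hasDerivWithinAt_iff_tendsto_slope' (by simp)] at h1
  exact h1.congr fun ε => by simp [slope_def_module]

end SimplePerturbation

/-! ### Measurability and norms of the feature maps. -/

theorem stronglyMeasurable_of_gram {Ω H : Type*} [MeasurableSpace Ω] [NormedAddCommGroup H]
    [InnerProductSpace ℝ H] [FiniteDimensional ℝ H] {φ : Ω → H}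
    (hspan : Submodule.span ℝ (Set.range φ) = ⊤)
    (hφ : ∀ ω', Measurable fun ω => ⟪φ ω', φ ω⟫_ℝ) : StronglyMeasurable φ := by
  -- The hypothesis covers `h` in the range of `φ`; linearity extends it to the span, which is
  -- everything.
  have h1 : ∀ h : H, Measurable fun ω => ⟪h, φ ω⟫_ℝ := by
    intro h
    have hh : h ∈ Submodule.span ℝ (Set.range φ) := by
      rw [hspan]; trivial
    induction hh using Submodule.span_induction with
    | mem y hy =>
      obtain ⟨ω', rfl⟩ := hy
      exact hφ ω'
    | zero => simp
    | add y y' _ _ hy hy' =>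
      simp only [inner_add_left]
      exact hy.add hy'
    | smul c y _ hy =>
      simp only [real_inner_smul_left]
      exact measurable_const.mul hy
  have h2 : φ = fun ω =>
      ∑ i, ⟪stdOrthonormalBasis ℝ H i, φ ω⟫_ℝ • stdOrthonormalBasis ℝ H i := by
    funext ω
    exact ((stdOrthonormalBasis ℝ H).sum_repr' (φ ω)).symm
  rw [h2]
  exact Finset.stronglyMeasurable_fun_sum _ fun i _ =>
    (h1 _).stronglyMeasurable.smul_const _

section Features

variable {𝒳 : Type*} {H : Type*} [NormedAddCommGroup H] [InnerProductSpace ℝ H]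
  [CompleteSpace H] [RKHS ℝ H 𝒳 ℝ]

theorem inner_feature_feature (x x' : 𝒳) :
    ⟪feature H x, feature H x'⟫_ℝ = scalarKernel H x x' := by
  rw [feature, feature, RKHS.kerFun_inner, RKHS.kerFun_apply, scalarKernel]
  simp

/-- A function orthogonal to every feature vanishes at every point, by the reproducing property. -/
theorem span_range_feature [FiniteDimensional ℝ H] :
    Submodule.span ℝ (Set.range (feature H : 𝒳 → H)) = ⊤ := by
  rw [← Submodule.orthogonal_eq_bot_iff, Submodule.eq_bot_iff]
  intro h hh
  refine DFunLike.ext h 0 fun x => ?_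
  have h1 := (Submodule.mem_orthogonal _ _).1 hh (feature H x)
    (Submodule.subset_span (Set.mem_range_self x))
  simpa [feature] using h1

theorem stronglyMeasurable_feature [FiniteDimensional ℝ H] [MeasurableSpace 𝒳]
    (hk : Measurable fun p : 𝒳 × 𝒳 => scalarKernel H p.1 p.2) :
    StronglyMeasurable (feature H : 𝒳 → H) := by
  refine stronglyMeasurable_of_gram span_range_feature fun x => ?_
  have hx : Measurable fun x' : 𝒳 => (x, x') := measurable_const.prodMk measurable_id
  have h : (fun x' => ⟪feature H x, feature H x'⟫_ℝ) =
      (fun p : 𝒳 × 𝒳 => scalarKernel H p.1 p.2) ∘ fun x' => (x, x') :=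
    funext fun x' => inner_feature_feature x x'
  rw [h]
  exact hk.comp hx

theorem norm_feature_sq (x : 𝒳) : ‖feature H x‖ ^ 2 = scalarKernel H x x := by
  rw [← real_inner_self_eq_norm_sq, inner_feature_feature]

end Features

/-! ### Covariance operators and their change under contamination. -/

section Measure

variable {Ω : Type*} [MeasurableSpace Ω]
  {H₁ : Type*} [NormedAddCommGroup H₁] [InnerProductSpace ℝ H₁]
  {H₂ : Type*} [NormedAddCommGroup H₂] [InnerProductSpace ℝ H₂]

theorem contaminate_zero (F : Measure Ω) (z : Ω) : contaminate F z 0 = F := by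
  simp [contaminate]

theorem integral_contaminate {G : Type*} [NormedAddCommGroup G] [NormedSpace ℝ G]
    [CompleteSpace G] (F : Measure Ω) (z : Ω) {ε : ℝ} (h0 : 0 ≤ ε)
    (h1 : ε ≤ 1) {φ : Ω → G} (hφ : StronglyMeasurable φ) (hφF : Integrable φ F) :
    ∫ ω, φ ω ∂(contaminate F z ε) = (1 - ε) • ∫ ω, φ ω ∂F + ε • φ z := by
  have hd : Integrable φ (Measure.dirac z) :=
    integrable_dirac' hφ (by simp)
  rw [contaminate, integral_add_measure (hφF.smul_measure ENNReal.ofReal_ne_top)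
    (hd.smul_measure ENNReal.ofReal_ne_top), integral_smul_measure, integral_smul_measure,
    integral_dirac' _ _ hφ, ENNReal.toReal_ofReal (by linarith), ENNReal.toReal_ofReal h0]

variable [FiniteDimensional ℝ H₁] [FiniteDimensional ℝ H₂]

/-- The adjoint as a real-linear isometry. -/
noncomputable def adjointIsometry (H₁ H₂ : Type*) [NormedAddCommGroup H₁] [InnerProductSpace ℝ H₁]
    [NormedAddCommGroup H₂] [InnerProductSpace ℝ H₂] [CompleteSpace H₁] [CompleteSpace H₂] :
    (H₁ →L[ℝ] H₂) →ₗᵢ[ℝ] (H₂ →L[ℝ] H₁) where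
  toFun T := ContinuousLinearMap.adjoint T
  map_add' := map_add _
  map_smul' c T := by simp
  norm_map' T := by simp

/-- Taking adjoints is an isometry, so it commutes with the Bochner integral even when the integrand
is not integrable; the identity thus holds for every measure. -/
theorem inner_crossCov_left (P : Measure Ω) (U : Ω → H₁) (V : Ω → H₂) (x : H₂) (y : H₁) :
    ⟪crossCov P U V x, y⟫_ℝ = ⟪x, crossCov P V U y⟫_ℝ := by
  have := FiniteDimensional.complete ℝ H₁
  have := FiniteDimensional.complete ℝ H₂
  have h : crossCov P V U = ContinuousLinearMap.adjoint (crossCov P U V) := by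
    have := (adjointIsometry H₂ H₁).integral_comp_comm (μ := P)
      fun ω => InnerProductSpace.rankOne ℝ (centered P U ω) (centered P V ω)
    refine Eq.trans ?_ this
    simp [adjointIsometry, crossCov]
  rw [h, ContinuousLinearMap.adjoint_inner_right]

omit [FiniteDimensional ℝ H₁] [FiniteDimensional ℝ H₂] in
theorem continuous_rankOne :
    Continuous fun p : H₁ × H₂ => InnerProductSpace.rankOne ℝ p.1 p.2 := by
  have : Continuous fun p : H₁ × H₂ => (innerSL ℝ p.2 : H₂ →L[ℝ] ℝ).smulRight p.1 := by
    fun_prop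
  exact this

omit [FiniteDimensional ℝ H₁] [FiniteDimensional ℝ H₂] in
theorem integrable_rankOne {P : Measure Ω} {U : Ω → H₁} {V : Ω → H₂} (hU : MemLp U 2 P)
    (hV : MemLp V 2 P) : Integrable (fun ω => InnerProductSpace.rankOne ℝ (U ω) (V ω)) P := by
  have hm := continuous_rankOne.comp_aestronglyMeasurable (hU.1.prodMk hV.1)
  have hi : Integrable (fun ω => ‖U ω‖ * ‖V ω‖) P := hU.norm.integrable_mul hV.norm
  exact hi.mono' hm (Eventually.of_forall fun ω => (InnerProductSpace.norm_rankOne _ _).le)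

omit [FiniteDimensional ℝ H₁] in
theorem memLp_centered {P : Measure Ω} [IsFiniteMeasure P] {U : Ω → H₁} (hU : MemLp U 2 P) :
    MemLp (centered P U) 2 P :=
  hU.sub (memLp_const _)

theorem inner_crossCov_self_nonneg (P : Measure Ω) (U : Ω → H₁) (x : H₁) :
    0 ≤ ⟪x, crossCov P U U x⟫_ℝ := by
  by_cases hi : Integrable (fun ω =>
      InnerProductSpace.rankOne ℝ (centered P U ω) (centered P U ω)) P
  · have := FiniteDimensional.complete ℝ H₁
    have h1 : ⟪x, crossCov P U U x⟫_ℝ = ∫ ω, ⟪x, centered P U ω⟫_ℝ ^ 2 ∂P := by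
      have h := (innerSL ℝ x ∘L ContinuousLinearMap.apply ℝ H₁ x).integral_comp_comm hi
      refine Eq.trans ?_ (h.symm.trans ?_)
      · simp [crossCov]
      · refine integral_congr_ae (Eventually.of_forall fun ω => ?_)
        simp [real_inner_comm x, sq]
    rw [h1]
    exact integral_nonneg fun ω => sq_nonneg _
  · rw [crossCov, integral_undef hi]; simp

/-- If the nonnegative form of `A` vanishes at `x`, its values at `x + t A x` form a quadratic in
`t` without constant term. Its linear coefficient `2 ‖A x‖²` must vanish, so `x = 0` by
invertibility. -/
theorem inner_crossCov_self_pos {P : Measure Ω} {U : Ω → H₁} (h : IsUnit (crossCov P U U)) (x : H₁)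
    (hx : x ≠ 0) : 0 < ⟪x, crossCov P U U x⟫_ℝ := by
  refine (inner_crossCov_self_nonneg P U x).lt_of_ne fun h0 => hx ?_
  set A := crossCov P U U with hA
  have hsymm : (A : H₁ →ₗ[ℝ] H₁).IsSymmetric := fun x y => inner_crossCov_left P U U x y
  have hzero : A x = 0 := by
    have key : ∀ t : ℝ, 0 ≤ 2 * ⟪A x, A x⟫_ℝ * t + ⟪A x, A (A x)⟫_ℝ * (t * t) := by
      intro t
      have h1 := inner_crossCov_self_nonneg P U (x + t • A x)
      rw [← hA] at h1
      have h2 : ⟪x, A (A x)⟫_ℝ = ⟪A x, A x⟫_ℝ := (hsymm x (A x)).symm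
      simp only [map_add, map_smul, inner_add_left, inner_add_right, inner_smul_left,
        inner_smul_right, ← h0, h2, conj_trivial] at h1
      linarith
    have hd := discrim_le_zero (a := ⟪A x, A (A x)⟫_ℝ) (b := 2 * ⟪A x, A x⟫_ℝ) (c := 0)
      (fun t => by have := key t; linarith)
    rw [discrim] at hd
    have : ⟪A x, A x⟫_ℝ = 0 := by nlinarith [sq_nonneg ⟪A x, A x⟫_ℝ]
    exact inner_self_eq_zero.1 this
  rw [← inverse_apply_apply h x, hzero, map_zero]

omit [FiniteDimensional ℝ H₁] in
theorem integral_centered [CompleteSpace H₁] {P : Measure Ω} [IsProbabilityMeasure P] {U : Ω → H₁}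
    (hU : Integrable U P) : ∫ ω, centered P U ω ∂P = 0 := by
  unfold centered
  rw [integral_sub hU (integrable_const _)]
  simp

omit [FiniteDimensional ℝ H₂] in
theorem integral_rankOne_centered_left {P : Measure Ω} [IsProbabilityMeasure P] {U : Ω → H₁}
    (hU : Integrable U P) (v : H₂) :
    ∫ ω, InnerProductSpace.rankOne ℝ (centered P U ω) v ∂P = 0 := by
  have := FiniteDimensional.complete ℝ H₁
  have h := ((InnerProductSpace.rankOne ℝ (E := H₁) (F := H₂)).flip v).integral_comp_comm
    (hU.sub (integrable_const (∫ ω', U ω' ∂P)))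
  refine Eq.trans h ?_
  have h2 := integral_centered hU
  unfold centered at h2
  simp only [Pi.sub_apply]
  rw [h2, map_zero]

theorem integral_rankOne_centered_right {P : Measure Ω} [IsProbabilityMeasure P] {V : Ω → H₂}
    (hV : Integrable V P) (u : H₁) :
    ∫ ω, InnerProductSpace.rankOne ℝ u (centered P V ω) ∂P = 0 := by
  have := FiniteDimensional.complete ℝ H₁
  have := FiniteDimensional.complete ℝ H₂
  have h := (adjointIsometry H₂ H₁).integral_comp_comm (μ := P)
    fun ω => InnerProductSpace.rankOne ℝ u (centered P V ω)
  have h2 : ∀ ω, adjointIsometry H₂ H₁ (InnerProductSpace.rankOne ℝ u (centered P V ω)) =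
      InnerProductSpace.rankOne ℝ (centered P V ω) u := fun ω =>
    InnerProductSpace.adjoint_rankOne u (centered P V ω)
  simp only [h2, integral_rankOne_centered_left hV] at h
  exact (adjointIsometry H₂ H₁).injective (by rw [← h, map_zero])

/-- The covariance operator `(1 - ε) (Σ + ε u ⊗ v)` of a contaminated distribution. -/
noncomputable def covPath (C : H₂ →L[ℝ] H₁) (u : H₁) (v : H₂) (ε : ℝ) : H₂ →L[ℝ] H₁ :=
  (1 - ε) • (C + ε • InnerProductSpace.rankOne ℝ u v)

/-- The mean moves by `ε u`. Recentering adds `ε² u ⊗ v` under `F`, the cross terms integrating to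
zero, while the point mass contributes `(1 - ε)² u ⊗ v`. The weights combine through `(1 - ε) ε² + ε
(1 - ε)² = (1 - ε) ε`. -/
theorem crossCov_contaminate {F : Measure Ω} [IsProbabilityMeasure F] {U : Ω → H₁} {V : Ω → H₂}
    (hU : StronglyMeasurable U) (hV : StronglyMeasurable V) (hU2 : MemLp U 2 F)
    (hV2 : MemLp V 2 F) (z : Ω) {ε : ℝ} (h0 : 0 ≤ ε) (h1 : ε ≤ 1) :
    crossCov (contaminate F z ε) U V =
      covPath (crossCov F U V) (centered F U z) (centered F V z) ε := by
  have := FiniteDimensional.complete ℝ H₁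
  have := FiniteDimensional.complete ℝ H₂
  have hUi : Integrable U F := hU2.integrable one_le_two
  have hVi : Integrable V F := hV2.integrable one_le_two
  have hcU : ∀ ω, centered (contaminate F z ε) U ω = centered F U ω - ε • centered F U z := by
    intro ω
    simp only [centered, integral_contaminate F z h0 h1 hU hUi]
    module
  have hcV : ∀ ω, centered (contaminate F z ε) V ω = centered F V ω - ε • centered F V z := by
    intro ω
    simp only [centered, integral_contaminate F z h0 h1 hV hVi]
    module
  set u := centered F U z with hu
  set v := centered F V z with hv
  have hcU2 : MemLp (fun ω => centered F U ω - ε • u) 2 F :=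
    (memLp_centered hU2).sub (memLp_const _)
  have hcV2 : MemLp (fun ω => centered F V ω - ε • v) 2 F :=
    (memLp_centered hV2).sub (memLp_const _)
  have hsm : StronglyMeasurable fun ω =>
      InnerProductSpace.rankOne ℝ (centered F U ω - ε • u) (centered F V ω - ε • v) :=
    continuous_rankOne.comp_stronglyMeasurable
      (((hU.sub stronglyMeasurable_const).sub stronglyMeasurable_const).prodMk
        ((hV.sub stronglyMeasurable_const).sub stronglyMeasurable_const))
  have hF : ∫ ω, InnerProductSpace.rankOne ℝ (centered F U ω - ε • u)
      (centered F V ω - ε • v) ∂F =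
      crossCov F U V + ε ^ 2 • InnerProductSpace.rankOne ℝ u v := by
    have e : ∀ ω, InnerProductSpace.rankOne ℝ (centered F U ω - ε • u)
        (centered F V ω - ε • v) =
        InnerProductSpace.rankOne ℝ (centered F U ω) (centered F V ω)
        - ε • InnerProductSpace.rankOne ℝ (centered F U ω) v
        - ε • InnerProductSpace.rankOne ℝ u (centered F V ω)
        + ε ^ 2 • InnerProductSpace.rankOne ℝ u v := by
      intro ω
      simp only [map_sub, sub_apply, map_smulₛₗ, smul_apply, conj_trivial, RingHom.id_apply]
      module
    have i1 := integrable_rankOne (memLp_centered hU2) (memLp_centered hV2)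
    have i2 := (integrable_rankOne (memLp_centered hU2) (memLp_const (μ := F) v)).fun_smul ε
    have i3 := (integrable_rankOne (memLp_const (μ := F) u) (memLp_centered hV2)).fun_smul ε
    have i12 := i1.sub' i2
    simp only [e]
    rw [integral_add (i12.sub' i3) (integrable_const _), integral_sub i12 i3,
      integral_sub i1 i2, integral_smul, integral_smul, integral_rankOne_centered_left hUi,
      integral_rankOne_centered_right hVi]
    simp [crossCov]
  rw [crossCov]
  simp only [hcU, hcV]
  rw [integral_contaminate F z h0 h1 hsm (integrable_rankOne hcU2 hcV2), hF, ← hu, ← hv, covPath]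
  have e : InnerProductSpace.rankOne ℝ (u - ε • u) (v - ε • v) =
      (1 - ε) ^ 2 • InnerProductSpace.rankOne ℝ u v := by
    simp only [map_sub, sub_apply, map_smulₛₗ, smul_apply, conj_trivial, RingHom.id_apply]
    module
  rw [e]
  module

end Measure

/-! ### The reduced resolvent of a pencil. -/

section PencilResolvent

variable {H : Type*} [NormedAddCommGroup H] [InnerProductSpace ℝ H] [FiniteDimensional ℝ H]
  {A M R S : H →L[ℝ] H}

namespace Represents

omit [FiniteDimensional ℝ H] in
theorem eigen_iff (h : Represents A M R S) {μ : ℝ} {x : H} :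
    S x = μ • x ↔ M (R x) = μ • A (R x) := by
  constructor
  · intro hx
    apply h.R_injective
    rw [← h.eq, hx, map_smul, h.RAR]
  · intro hx
    rw [h.eq, hx, map_smul, h.RAR]

theorem exists_eigen {n : ℕ} (h : Represents A M R S) (hn : Module.finrank ℝ H = n) (j : Fin n) :
    ∃ x, x ≠ 0 ∧ M x = h.symm_S.eigenvalues hn j • A x := by
  have hne := (h.symm_S.hasEigenvector_eigenvectorBasis hn j).2
  refine ⟨R (h.symm_S.eigenvectorBasis hn j), ?_, ?_⟩
  · rw [← map_zero R]
    exact fun h0 => hne (h.R_injective h0)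
  · exact h.eigen_iff.1 (h.symm_S.apply_eigenvectorBasis hn j)

omit [FiniteDimensional ℝ H] in
theorem isSymmetric_sub (h : Represents A M R S) (μ : ℝ) :
    ((S - μ • ContinuousLinearMap.id ℝ H : H →L[ℝ] H) : H →ₗ[ℝ] H).IsSymmetric := by
  intro x y
  have := h.symm_S x y
  simp only [ContinuousLinearMap.coe_coe] at this
  simp [inner_sub_left, inner_sub_right, inner_smul_left, inner_smul_right, this]

/-- In the coordinates `x = R y`, `f = R e`, the pencil becomes `S - μ`, whose kernel is the line
through `e` by simplicity. There `pinv` inverts it off `e`, and `⟪e, y⟫ = ⟪f, A x⟫`. -/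
theorem resolvent_apply (h : Represents A M R S) {μ : ℝ}
    (hdim : Module.finrank ℝ (Module.End.eigenspace (S : H →ₗ[ℝ] H) μ) = 1) {f : H}
    (hf : M f = μ • A f) (hnorm : ⟪f, A f⟫_ℝ = 1) (x : H) :
    R (pinv (S - μ • ContinuousLinearMap.id ℝ H) (R (M x - μ • A x))) =
      x - ⟪f, A x⟫_ℝ • f := by
  obtain ⟨y, rfl⟩ := h.R_surjective x
  obtain ⟨e, rfl⟩ := h.R_surjective f
  have hTe : S e = μ • e := h.eigen_iff.2 hf
  have he : ⟪e, e⟫_ℝ = 1 := by rw [h.inner_self, hnorm]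
  have hmem : e ∈ Module.End.eigenspace (S : H →ₗ[ℝ] H) μ :=
    Module.End.mem_eigenspace_iff.2 hTe
  have hker : ∀ w, (S - μ • ContinuousLinearMap.id ℝ H) w = 0 → ∃ c : ℝ, w = c • e := by
    intro w hw
    have hw' : w ∈ Module.End.eigenspace (S : H →ₗ[ℝ] H) μ :=
      Module.End.mem_eigenspace_iff.2 (by simpa [sub_eq_zero] using hw)
    have hne : (⟨e, hmem⟩ : Module.End.eigenspace (S : H →ₗ[ℝ] H) μ) ≠ 0 := by
      intro h0
      have h1 : e = 0 := congrArg Subtype.val h0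
      simp [h1] at he
    obtain ⟨c, hc⟩ := (finrank_eq_one_iff_of_nonzero' _ hne).1 hdim ⟨w, hw'⟩
    exact ⟨c, (congrArg Subtype.val hc).symm⟩
  have h1 : R (M (R y) - μ • A (R y)) = (S - μ • ContinuousLinearMap.id ℝ H) y := by
    simp [h.eq, h.RAR]
  rw [h1, pinv_apply_apply (h.isSymmetric_sub μ) he (by simp [hTe]) hker, map_sub, map_smul,
    h.symm_R, h.RAR]

theorem resolvent_apply_self (h : Represents A M R S) {μ : ℝ} {f : H} (hf : M f = μ • A f) :
    R (pinv (S - μ • ContinuousLinearMap.id ℝ H) (R (A f))) = 0 := by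
  obtain ⟨e, rfl⟩ := h.R_surjective f
  have hTe : S e = μ • e := h.eigen_iff.2 hf
  rw [h.RAR, pinv_apply_of_ker (h.isSymmetric_sub μ) (by simp [hTe]), map_zero]

end Represents

end PencilResolvent

/-! ### Canonical correlations as eigenvalues of a pencil. -/

section CanonicalCorrelation

variable {Ω : Type*} [MeasurableSpace Ω]
  {H₁ : Type*} [NormedAddCommGroup H₁] [InnerProductSpace ℝ H₁] [FiniteDimensional ℝ H₁]
  {H₂ : Type*} [NormedAddCommGroup H₂] [InnerProductSpace ℝ H₂] [FiniteDimensional ℝ H₂]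

/-- The operator `Σ_UV Σ_VV^{-1} Σ_VU`. -/
noncomputable def explainedCov (P : Measure Ω) (U : Ω → H₁) (V : Ω → H₂) : H₁ →L[ℝ] H₁ :=
  crossCov P U V ∘L Ring.inverse (crossCov P V V) ∘L crossCov P V U

theorem crossCov_isSymmetric (P : Measure Ω) (U : Ω → H₁) :
    (crossCov P U U : H₁ →ₗ[ℝ] H₁).IsSymmetric := fun x y => inner_crossCov_left P U U x y

theorem inner_inverse_crossCov_left {P : Measure Ω} {V : Ω → H₂} (hV : IsUnit (crossCov P V V))
    (x y : H₂) : ⟪Ring.inverse (crossCov P V V) x, y⟫_ℝ =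
      ⟪x, Ring.inverse (crossCov P V V) y⟫_ℝ := by
  conv_lhs => rw [← apply_inverse_apply hV y]
  rw [← inner_crossCov_left, apply_inverse_apply hV]

theorem inner_explainedCov_left {P : Measure Ω} (U : Ω → H₁) {V : Ω → H₂}
    (hV : IsUnit (crossCov P V V)) (x y : H₁) :
    ⟪explainedCov P U V x, y⟫_ℝ = ⟪x, explainedCov P U V y⟫_ℝ := by
  simp only [explainedCov, ContinuousLinearMap.comp_apply]
  rw [inner_crossCov_left, inner_inverse_crossCov_left hV, inner_crossCov_left]

theorem represents_ccaOp {P : Measure Ω} {U : Ω → H₁} {V : Ω → H₂}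
    (hU : IsUnit (crossCov P U U)) (hV : IsUnit (crossCov P V V)) :
    Represents (crossCov P U U) (explainedCov P U V) (invSqrt (crossCov P U U))
      (ccaOp P U V) where
  symm_R := inner_invSqrt_left _
  RAR := invSqrt_apply_apply_apply (crossCov_isSymmetric P U) (inner_crossCov_self_pos hU)
  symm_S x y := by
    have := inner_explainedCov_left U hV (invSqrt (crossCov P U U) x) (invSqrt (crossCov P U U) y)
    rw [← inner_invSqrt_left, inner_invSqrt_left _ x] at this
    exact this
  eq _ := rfl

theorem corrOp_adjoint (P : Measure Ω) (U : Ω → H₁) (V : Ω → H₂) :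
    LinearMap.adjoint (corrOp P U V : H₁ →ₗ[ℝ] H₂) = (corrOp P V U : H₂ →ₗ[ℝ] H₁) := by
  symm
  rw [LinearMap.eq_adjoint_iff]
  intro x y
  simp only [corrOp, ContinuousLinearMap.coe_coe, ContinuousLinearMap.comp_apply]
  rw [inner_invSqrt_left, inner_crossCov_left, inner_invSqrt_left]

theorem kernelCC_comm (P : Measure Ω) (U : Ω → H₁) (V : Ω → H₂) {j : ℕ}
    (h₁ : j < Module.finrank ℝ H₁) (h₂ : j < Module.finrank ℝ H₂) :
    kernelCC P V U j = kernelCC P U V j := by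
  rw [kernelCC, ← corrOp_adjoint, singularValues_adjoint _ h₁ h₂, kernelCC]

/-- The two factors `Σ_VV^{-1/2}` meet in the middle and form `Σ_VV⁻¹`; this turns singular values
into eigenvalues of `ccaOp`. -/
theorem corrOp_adjoint_comp_self {P : Measure Ω} (U : Ω → H₁) {V : Ω → H₂}
    (hV : IsUnit (crossCov P V V)) :
    LinearMap.adjoint (corrOp P U V : H₁ →ₗ[ℝ] H₂) ∘ₗ (corrOp P U V : H₁ →ₗ[ℝ] H₂) =
      (ccaOp P U V : H₁ →ₗ[ℝ] H₁) := by
  rw [corrOp_adjoint]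
  ext x
  simp only [corrOp, ccaOp, LinearMap.comp_apply, ContinuousLinearMap.coe_coe,
    ContinuousLinearMap.comp_apply]
  rw [invSqrt_invSqrt_eq_inverse (crossCov_isSymmetric P V) (inner_crossCov_self_pos hV)]

theorem kernelCC_sq {P : Measure Ω} {U : Ω → H₁} {V : Ω → H₂} (hV : IsUnit (crossCov P V V))
    (hS : (ccaOp P U V : H₁ →ₗ[ℝ] H₁).IsSymmetric) {j : ℕ} (hj : j < Module.finrank ℝ H₁) :
    kernelCC P U V j ^ 2 = hS.eigenvalues rfl ⟨j, hj⟩ := by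
  rw [kernelCC, LinearMap.sq_singularValues_of_lt _ rfl hj]
  congr 1
  exact corrOp_adjoint_comp_self U hV

end CanonicalCorrelation

/-! ### Derivatives along the contamination path and the influence functions. -/

section Contamination

variable {H₁ : Type*} [NormedAddCommGroup H₁] [InnerProductSpace ℝ H₁] [FiniteDimensional ℝ H₁]
  {H₂ : Type*} [NormedAddCommGroup H₂] [InnerProductSpace ℝ H₂] [FiniteDimensional ℝ H₂]

omit [FiniteDimensional ℝ H₁] [FiniteDimensional ℝ H₂] in
theorem covPath_zero (C : H₂ →L[ℝ] H₁) (u : H₁) (v : H₂) : covPath C u v 0 = C := by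
  simp [covPath]

omit [FiniteDimensional ℝ H₁] [FiniteDimensional ℝ H₂] in
theorem hasDerivAt_covPath (C : H₂ →L[ℝ] H₁) (u : H₁) (v : H₂) :
    HasDerivAt (covPath C u v) (-C + InnerProductSpace.rankOne ℝ u v) 0 := by
  have h := ((hasDerivAt_id (0 : ℝ)).const_sub 1).smul
    (((hasDerivAt_id (0 : ℝ)).smul_const (InnerProductSpace.rankOne ℝ u v)).const_add C)
  refine h.congr_deriv ?_
  simp
  abel

omit [FiniteDimensional ℝ H₁] in
theorem covPath_pos {A : H₁ →L[ℝ] H₁} (hA : ∀ x, x ≠ 0 → 0 < ⟪x, A x⟫_ℝ) (u : H₁) {ε : ℝ}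
    (h0 : 0 ≤ ε) (h1 : ε < 1) (x : H₁) (hx : x ≠ 0) : 0 < ⟪x, covPath A u u ε x⟫_ℝ := by
  have h2 : ⟪x, covPath A u u ε x⟫_ℝ = (1 - ε) * (⟪x, A x⟫_ℝ + ε * ⟪u, x⟫_ℝ ^ 2) := by
    simp only [covPath, smul_apply, add_apply, inner_smul_right, inner_add_right,
      InnerProductSpace.rankOne_apply, real_inner_comm x u]
    ring
  rw [h2]
  have := hA x hx
  have : 0 < 1 - ε := by linarith
  positivity

theorem hasDerivAt_inverse {B : ℝ → H₂ →L[ℝ] H₂} {B' : H₂ →L[ℝ] H₂} (hB : HasDerivAt B B' 0)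
    (hu : IsUnit (B 0)) : HasDerivAt (fun ε => Ring.inverse (B ε))
      (-(Ring.inverse (B 0) ∘L B' ∘L Ring.inverse (B 0))) 0 := by
  have := FiniteDimensional.complete ℝ H₂
  obtain ⟨b, hb⟩ := hu
  have h := hasFDerivAt_ringInverse (𝕜 := ℝ) b
  rw [hb] at h
  refine (h.comp_hasDerivAt 0 hB).congr_deriv ?_
  rw [← hb, Ring.inverse_unit]
  rfl

variable {Ω : Type*} [MeasurableSpace Ω] {F : Measure Ω} [IsProbabilityMeasure F]
  {U : Ω → H₁} {V : Ω → H₂}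

theorem isUnit_crossCov_contaminate (hU : StronglyMeasurable U) (hU2 : MemLp U 2 F)
    (hUU : IsUnit (crossCov F U U)) (z : Ω) {ε : ℝ} (h0 : 0 ≤ ε) (h1 : ε < 1) :
    IsUnit (crossCov (contaminate F z ε) U U) := by
  rw [crossCov_contaminate hU hU hU2 hU2 z h0 h1.le]
  exact isUnit_of_pos (covPath_pos (inner_crossCov_self_pos hUU) _ h0 h1)

/-- The operator `Σ_UV Σ_VV^{-1} Σ_VU` along the contamination path. -/
noncomputable def explainedPath (F : Measure Ω) (U : Ω → H₁) (V : Ω → H₂) (z : Ω) (ε : ℝ) :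
    H₁ →L[ℝ] H₁ :=
  covPath (crossCov F U V) (centered F U z) (centered F V z) ε ∘L
    Ring.inverse (covPath (crossCov F V V) (centered F V z) (centered F V z) ε) ∘L
      covPath (crossCov F V U) (centered F V z) (centered F U z) ε

/-- The derivative at `0` of `explainedPath`. -/
noncomputable def explainedDeriv (F : Measure Ω) (U : Ω → H₁) (V : Ω → H₂) (z : Ω) :
    H₁ →L[ℝ] H₁ :=
  (-crossCov F U V + InnerProductSpace.rankOne ℝ (centered F U z) (centered F V z)) ∘L
      Ring.inverse (crossCov F V V) ∘L crossCov F V U +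
    crossCov F U V ∘L
      (-(Ring.inverse (crossCov F V V) ∘L
          (-crossCov F V V + InnerProductSpace.rankOne ℝ (centered F V z) (centered F V z)) ∘L
          Ring.inverse (crossCov F V V)) ∘L crossCov F V U +
        Ring.inverse (crossCov F V V) ∘L
          (-crossCov F V U + InnerProductSpace.rankOne ℝ (centered F V z) (centered F U z)))

theorem explainedCov_contaminate (hU : StronglyMeasurable U) (hV : StronglyMeasurable V)
    (hU2 : MemLp U 2 F) (hV2 : MemLp V 2 F) (z : Ω) {ε : ℝ} (h0 : 0 ≤ ε) (h1 : ε ≤ 1) :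
    explainedCov (contaminate F z ε) U V = explainedPath F U V z ε := by
  rw [explainedCov, crossCov_contaminate hU hV hU2 hV2 z h0 h1,
    crossCov_contaminate hV hV hV2 hV2 z h0 h1, crossCov_contaminate hV hU hV2 hU2 z h0 h1,
    explainedPath]

omit [IsProbabilityMeasure F] [FiniteDimensional ℝ H₁] in
theorem hasDerivAt_explainedPath (hVV : IsUnit (crossCov F V V)) (z : Ω) :
    HasDerivAt (explainedPath F U V z) (explainedDeriv F U V z) 0 := by
  have hB := hasDerivAt_inverse
    (hasDerivAt_covPath (crossCov F V V) (centered F V z) (centered F V z))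
    (by rwa [covPath_zero])
  have h := (hasDerivAt_covPath (crossCov F U V) (centered F U z) (centered F V z)).clm_comp
    (hB.clm_comp (hasDerivAt_covPath (crossCov F V U) (centered F V z) (centered F U z)))
  refine h.congr_deriv ?_
  simp only [covPath_zero]
  rfl

omit [IsProbabilityMeasure F] [FiniteDimensional ℝ H₁] [FiniteDimensional ℝ H₂] in
-- The common factor `1 - ε` scales `M` and `A` alike, so its contributions cancel by the eigenvalue
-- equation. Only the rank-one terms remain, and `Σ_VV⁻¹ Σ_VU f = ρ g` evaluates them.
theorem explainedDeriv_sub_apply (hVV : IsUnit (crossCov F V V)) {ρ : ℝ} {f : H₁} {g : H₂}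
    (hfg : IsCanonicalPair F U V ρ f g) (z : Ω) :
    explainedDeriv F U V z f - ρ ^ 2 • (-crossCov F U U +
      InnerProductSpace.rankOne ℝ (centered F U z) (centered F U z)) f =
    (ρ * (⟪g, centered F V z⟫_ℝ - ρ * ⟪f, centered F U z⟫_ℝ)) • centered F U z +
      (⟪f, centered F U z⟫_ℝ - ρ * ⟪g, centered F V z⟫_ℝ) •
        crossCov F U V (Ring.inverse (crossCov F V V) (centered F V z)) := by
  have h1 := hfg.left
  have h2 := hfg.right
  have h3 := fun y => inverse_apply_apply hVV y
  simp only [explainedDeriv, add_apply, ContinuousLinearMap.comp_apply, neg_apply, map_add,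
    map_neg, map_smul, InnerProductSpace.rankOne_apply, h1, h2, h3,
    real_inner_comm g, real_inner_comm f]
  module

theorem simplePerturbation_contaminate (hU : StronglyMeasurable U) (hV : StronglyMeasurable V)
    (hU2 : MemLp U 2 F) (hV2 : MemLp V 2 F) (hUU : IsUnit (crossCov F U U))
    (hVV : IsUnit (crossCov F V V)) {j : ℕ} (hj : j < Module.finrank ℝ H₁) {ρ : ℝ}
    (hρ : ρ = kernelCC F U V j) (hs : IsSimpleCC F U V ρ) {f : H₁} {g : H₂}
    (hfg : IsCanonicalPair F U V ρ f g) (z : Ω) :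
    SimplePerturbation (covPath (crossCov F U U) (centered F U z) (centered F U z))
      (explainedPath F U V z)
      (-crossCov F U U + InnerProductSpace.rankOne ℝ (centered F U z) (centered F U z))
      (explainedDeriv F U V z) (resolventOp F U V ρ)
      (fun ε => kernelCC (contaminate F z ε) U V j ^ 2) f := by
  have hM0 : explainedPath F U V z 0 = explainedCov F U V := by
    simp only [explainedPath, covPath_zero, explainedCov]
  have hlam0 : kernelCC (contaminate F z 0) U V j ^ 2 = ρ ^ 2 := by
    rw [contaminate_zero, hρ]
  have hrep := represents_ccaOp hUU hVV
  have hf : explainedCov F U V f = ρ ^ 2 • crossCov F U U f := by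
    simp only [explainedCov, ContinuousLinearMap.comp_apply, hfg.right, map_smul,
      inverse_apply_apply hVV, hfg.left, smul_smul, sq]
  have hsmall : ∀ᶠ ε in 𝓝[>] (0 : ℝ), ε ∈ Set.Ioo (0 : ℝ) 1 := Ioo_mem_nhdsGT one_pos
  have hlam : ∀ᶠ ε in 𝓝[>] (0 : ℝ),
      ∃ hi : Represents (covPath (crossCov F U U) (centered F U z) (centered F U z) ε)
        (explainedPath F U V z ε) (invSqrt (crossCov (contaminate F z ε) U U))
        (ccaOp (contaminate F z ε) U V),
      kernelCC (contaminate F z ε) U V j ^ 2 = hi.symm_S.eigenvalues rfl ⟨j, hj⟩ := by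
    filter_upwards [hsmall] with ε ⟨h0, h1⟩
    have hVε := isUnit_crossCov_contaminate hV hV2 hVV z h0.le h1
    have hr := represents_ccaOp (isUnit_crossCov_contaminate hU hU2 hUU z h0.le h1) hVε
    have hk := kernelCC_sq hVε hr.symm_S hj
    rw [explainedCov_contaminate hU hV hU2 hV2 z h0.le h1.le,
      crossCov_contaminate hU hU hU2 hU2 z h0.le h1.le] at hr
    rw [crossCov_contaminate hU hU hU2 hU2 z h0.le h1.le]
    exact ⟨hr, hk⟩
  have hdA := hasDerivAt_covPath (crossCov F U U) (centered F U z) (centered F U z)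
  have hdM := hasDerivAt_explainedPath (U := U) hVV z
  constructor
  · exact hdA.hasDerivWithinAt
  · exact hdM.hasDerivWithinAt
  · have htA : Tendsto (covPath (crossCov F U U) (centered F U z) (centered F U z)) (𝓝[>] 0)
        (𝓝 (crossCov F U U)) := by
      have := hdA.continuousAt.tendsto.mono_left (nhdsWithin_le_nhds (s := Set.Ioi 0))
      rwa [covPath_zero] at this
    have htM : Tendsto (explainedPath F U V z) (𝓝[>] 0) (𝓝 (explainedCov F U V)) := by
      have := hdM.continuousAt.tendsto.mono_left (nhdsWithin_le_nhds (s := Set.Ioi 0))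
      rwa [hM0] at this
    have h := hrep.tendsto_eigenvalue htA htM rfl ⟨j, hj⟩ hlam
    rw [← kernelCC_sq hVV hrep.symm_S hj] at h
    simpa only [contaminate_zero] using h
  · filter_upwards [hlam] with ε ⟨hr, hl⟩
    rw [hl]
    exact hr.exists_eigen rfl ⟨j, hj⟩
  · filter_upwards [hsmall] with ε ⟨h0, h1⟩
    exact covPath_pos (inner_crossCov_self_pos hUU) _ h0.le h1
  · rw [covPath_zero]; exact inner_crossCov_left F U U
  · rw [hM0]; exact inner_explainedCov_left U hVV
  · simp only [covPath_zero, hM0, hlam0, hf]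
  · rw [covPath_zero]; exact hfg.unit_variance_left
  · intro h
    simp only [covPath_zero, hM0, hlam0]
    exact hrep.resolvent_apply hs hf hfg.unit_variance_left h
  · rw [covPath_zero]
    exact hrep.resolvent_apply_self hf

/-- The influence functions of the squared canonical correlation and of the canonical variate on
the side of `U`. -/
theorem influence_canonical (hU : StronglyMeasurable U) (hV : StronglyMeasurable V)
    (hU2 : MemLp U 2 F) (hV2 : MemLp V 2 F) (hUU : IsUnit (crossCov F U U))
    (hVV : IsUnit (crossCov F V V)) {j : ℕ} (hj : j < Module.finrank ℝ H₁) {ρ : ℝ}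
    (hρ : ρ = kernelCC F U V j) (hs : IsSimpleCC F U V ρ) {f : H₁} {g : H₂}
    (hfg : IsCanonicalPair F U V ρ f g) (z : Ω) {a b : ℝ} (ha : a = ⟪f, centered F U z⟫_ℝ)
    (hb : b = ⟪g, centered F V z⟫_ℝ) :
    HasInfluence (fun G => kernelCC G U V j ^ 2) F z
      (-(ρ ^ 2 * a ^ 2) + 2 * ρ * a * b - ρ ^ 2 * b ^ 2) ∧
    ((∀ᶠ ε in 𝓝[>] (0 : ℝ), ∃! h : H₁,
        IsVariate (contaminate F z ε) U V (kernelCC (contaminate F z ε) U V j) h ∧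
          0 < ⟪h, crossCov F U U f⟫_ℝ) ∧
      ∀ T : Measure Ω → H₁, T F = f →
        (∀ᶠ ε in 𝓝[>] (0 : ℝ),
          IsVariate (contaminate F z ε) U V (kernelCC (contaminate F z ε) U V j)
            (T (contaminate F z ε)) ∧
          0 < ⟪T (contaminate F z ε), crossCov F U U f⟫_ℝ) →
        HasInfluence T F z
          (-(ρ * (b - ρ * a)) • resolventOp F U V ρ (centered F U z)
            - (a - ρ * b) • resolventOp F U V ρ
                (crossCov F U V (Ring.inverse (crossCov F V V) (centered F V z)))
            + ((1 / 2 : ℝ) * (1 - a ^ 2)) • f)) := by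
  have hp := simplePerturbation_contaminate hU hV hU2 hV2 hUU hVV hj hρ hs hfg z
  have hlam0 : kernelCC (contaminate F z 0) U V j ^ 2 = ρ ^ 2 := by
    rw [contaminate_zero, hρ]
  have hD := explainedDeriv_sub_apply hVV hfg z
  rw [← ha, ← hb] at hD
  -- The explicit paths agree with the operators of the contaminated measure only for `ε` in the
  -- unit interval, so the translation of variates into eigenvectors holds eventually.
  have hiff : ∀ᶠ ε in 𝓝[>] (0 : ℝ), ∀ x : H₁,
      (IsVariate (contaminate F z ε) U V (kernelCC (contaminate F z ε) U V j) x ∧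
        0 < ⟪x, crossCov F U U f⟫_ℝ) ↔
      ((explainedPath F U V z ε x = kernelCC (contaminate F z ε) U V j ^ 2 •
          covPath (crossCov F U U) (centered F U z) (centered F U z) ε x ∧
        ⟪x, covPath (crossCov F U U) (centered F U z) (centered F U z) ε x⟫_ℝ = 1) ∧
        0 < ⟪x, covPath (crossCov F U U) (centered F U z) (centered F U z) 0 f⟫_ℝ) := by
    filter_upwards [Ioo_mem_nhdsGT one_pos] with ε ⟨h0, h1⟩ x
    rw [covPath_zero, ← explainedCov_contaminate hU hV hU2 hV2 z h0.le h1.le,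
      ← crossCov_contaminate hU hU hU2 hU2 z h0.le h1.le]
    exact and_congr_left fun _ => ⟨fun h => ⟨h.1, h.2⟩, fun h => ⟨h.1, h.2⟩⟩
  refine ⟨?_, ?_, ?_⟩
  · have h := hp.tendsto_lam_slope
    rw [hlam0, hD] at h
    -- Moving the operators to the other side turns `f` into `Σ_VV⁻¹ Σ_VU f = ρ g`.
    have hinner : ⟪f, crossCov F U V (Ring.inverse (crossCov F V V) (centered F V z))⟫_ℝ =
        ρ * b := by
      rw [real_inner_comm, inner_crossCov_left, hfg.right, inner_smul_right,
        ← inner_crossCov_left, apply_inverse_apply hVV, hb, real_inner_comm]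
    rw [inner_add_right, inner_smul_right, inner_smul_right, hinner, ← ha] at h
    unfold HasInfluence
    convert h using 2
    · rw [hρ]
    · ring
  · filter_upwards [hiff, hp.eventually_existsUnique] with ε hε hu
    simpa only [hε] using hu
  · intro T hT hv
    have h := hp.tendsto_variate_slope (v := fun ε => T (contaminate F z ε))
      (by rw [contaminate_zero, hT])
      (by filter_upwards [hiff, hv] with ε hε h using (hε _).1 h)
    rw [hlam0, hD, contaminate_zero] at h
    unfold HasInfluence
    convert h using 2
    have hA' : ⟪f, (-crossCov F U U +
        InnerProductSpace.rankOne ℝ (centered F U z) (centered F U z)) f⟫_ℝ = -1 + a ^ 2 := by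
      simp only [add_apply, neg_apply, InnerProductSpace.rankOne_apply, inner_add_right,
        inner_neg_right, inner_smul_right, hfg.unit_variance_left, real_inner_comm f, ← ha]
      ring
    rw [hA', map_add, map_smul, map_smul]
    module

end Contamination

/-! ### Assembly for the two feature maps. -/

theorem stronglyMeasurable_featX {𝒳 𝒴 H : Type*} [MeasurableSpace 𝒳] [MeasurableSpace 𝒴]
    [NormedAddCommGroup H] [InnerProductSpace ℝ H] [CompleteSpace H] [RKHS ℝ H 𝒳 ℝ]
    [FiniteDimensional ℝ H] (hk : Measurable fun p : 𝒳 × 𝒳 => scalarKernel H p.1 p.2) :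
    StronglyMeasurable (featX 𝒴 H : 𝒳 × 𝒴 → H) :=
  (stronglyMeasurable_feature hk).comp_measurable measurable_fst

theorem stronglyMeasurable_featY {𝒳 𝒴 H : Type*} [MeasurableSpace 𝒳] [MeasurableSpace 𝒴]
    [NormedAddCommGroup H] [InnerProductSpace ℝ H] [CompleteSpace H] [RKHS ℝ H 𝒴 ℝ]
    [FiniteDimensional ℝ H] (hk : Measurable fun p : 𝒴 × 𝒴 => scalarKernel H p.1 p.2) :
    StronglyMeasurable (featY 𝒳 H : 𝒳 × 𝒴 → H) :=
  (stronglyMeasurable_feature hk).comp_measurable measurable_snd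

theorem IsCanonicalPair.symm {Ω H₁ H₂ : Type*} [MeasurableSpace Ω] [NormedAddCommGroup H₁]
    [InnerProductSpace ℝ H₁] [NormedAddCommGroup H₂] [InnerProductSpace ℝ H₂] {P : Measure Ω}
    {U : Ω → H₁} {V : Ω → H₂} {ρ : ℝ} {f : H₁} {g : H₂} (h : IsCanonicalPair P U V ρ f g) :
    IsCanonicalPair P V U ρ g f :=
  ⟨h.right, h.left, h.unit_variance_right, h.unit_variance_left⟩

end KCCA

theorem theorem1 {𝒳 𝒴 HX HY : Type*} [MeasurableSpace 𝒳] [MeasurableSpace 𝒴]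
    [NormedAddCommGroup HX] [InnerProductSpace ℝ HX] [CompleteSpace HX] [RKHS ℝ HX 𝒳 ℝ]
    [NormedAddCommGroup HY] [InnerProductSpace ℝ HY] [CompleteSpace HY] [RKHS ℝ HY 𝒴 ℝ]
    [FiniteDimensional ℝ HX] [FiniteDimensional ℝ HY]
    (hkX : Measurable fun p : 𝒳 × 𝒳 => scalarKernel HX p.1 p.2)
    (hkY : Measurable fun p : 𝒴 × 𝒴 => scalarKernel HY p.1 p.2)
    (F : Measure (𝒳 × 𝒴)) [IsProbabilityMeasure F]
    (hFX : Integrable (fun z => scalarKernel HX z.1 z.1) F)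
    (hFY : Integrable (fun z => scalarKernel HY z.2 z.2) F)
    (U : 𝒳 × 𝒴 → HX) (hU : U = featX 𝒴 HX)
    (V : 𝒳 × 𝒴 → HY) (hV : V = featY 𝒳 HY)
    (hXX : IsUnit (crossCov F U U)) (hYY : IsUnit (crossCov F V V))
    (j : ℕ) (hjX : j < Module.finrank ℝ HX) (hjY : j < Module.finrank ℝ HY)
    (ρ : ℝ) (hρ : ρ = kernelCC F U V j)
    (hsX : IsSimpleCC F U V ρ) (hsY : IsSimpleCC F V U ρ)
    (f : HX) (g : HY) (hfg : IsCanonicalPair F U V ρ f g)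
    (z : 𝒳 × 𝒴)
    (a b : ℝ) (ha : a = ⟪f, centered F U z⟫_ℝ) (hb : b = ⟪g, centered F V z⟫_ℝ) :
    HasInfluence (fun G => kernelCC G U V j ^ 2) F z
      (-(ρ ^ 2 * a ^ 2) + 2 * ρ * a * b - ρ ^ 2 * b ^ 2) ∧
    ((∀ᶠ ε in 𝓝[>] (0 : ℝ), ∃! h : HX,
        IsVariate (contaminate F z ε) U V (kernelCC (contaminate F z ε) U V j) h ∧
          0 < ⟪h, crossCov F U U f⟫_ℝ) ∧
      ∀ T : Measure (𝒳 × 𝒴) → HX, T F = f →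
        (∀ᶠ ε in 𝓝[>] (0 : ℝ),
          IsVariate (contaminate F z ε) U V (kernelCC (contaminate F z ε) U V j)
            (T (contaminate F z ε)) ∧
          0 < ⟪T (contaminate F z ε), crossCov F U U f⟫_ℝ) →
        HasInfluence T F z
          (-(ρ * (b - ρ * a)) • resolventOp F U V ρ (centered F U z)
            - (a - ρ * b) • resolventOp F U V ρ
                (crossCov F U V (Ring.inverse (crossCov F V V) (centered F V z)))
            + ((1 / 2 : ℝ) * (1 - a ^ 2)) • f)) ∧
    ((∀ᶠ ε in 𝓝[>] (0 : ℝ), ∃! h : HY,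
        IsVariate (contaminate F z ε) V U (kernelCC (contaminate F z ε) U V j) h ∧
          0 < ⟪h, crossCov F V V g⟫_ℝ) ∧
      ∀ T : Measure (𝒳 × 𝒴) → HY, T F = g →
        (∀ᶠ ε in 𝓝[>] (0 : ℝ),
          IsVariate (contaminate F z ε) V U (kernelCC (contaminate F z ε) U V j)
            (T (contaminate F z ε)) ∧
          0 < ⟪T (contaminate F z ε), crossCov F V V g⟫_ℝ) →
        HasInfluence T F z
          (-(ρ * (a - ρ * b)) • resolventOp F V U ρ (centered F V z)
            - (b - ρ * a) • resolventOp F V U ρ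
                (crossCov F V U (Ring.inverse (crossCov F U U) (centered F U z)))
            + ((1 / 2 : ℝ) * (1 - b ^ 2)) • g)) := by

  have hUm : StronglyMeasurable U := hU ▸ stronglyMeasurable_featX hkX
  have hVm : StronglyMeasurable V := hV ▸ stronglyMeasurable_featY hkY
  have hU2 : MemLp U 2 F := by
    rw [memLp_two_iff_integrable_sq_norm hUm.aestronglyMeasurable]
    simpa only [hU, featX, norm_feature_sq] using hFX
  have hV2 : MemLp V 2 F := by
    rw [memLp_two_iff_integrable_sq_norm hVm.aestronglyMeasurable]
    simpa only [hV, featY, norm_feature_sq] using hFY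
  -- Needed for every measure, since the exchanged statement also speaks of the correlations of the
  -- contaminated distributions.
  have hcc : ∀ P, kernelCC P V U j = kernelCC P U V j := fun P => kernelCC_comm P U V hjX hjY
  obtain ⟨hcorr, hleft⟩ :=
    influence_canonical hUm hVm hU2 hV2 hXX hYY hjX hρ hsX hfg z ha hb
  have hright := (influence_canonical hVm hUm hV2 hU2 hYY hXX hjY (hρ.trans (hcc F).symm) hsY
    hfg.symm z hb ha).2
  simp only [hcc] at hright
  exact ⟨hcorr, hleft, hright⟩
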